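/- **Setting.** Let $D=(V,A)$ be a finite connected directed graph without parallel arcs, with integer flow balances $b_i$ ($i\in V$) and integer capacities $0\le l_a\le u_a<\infty$ ($a\in A$). A (feasible) flow is an integer vector $f\in\mathbb Z^A$ with $\sum_{j:(i,j)\in A} f_{ij}-\sum_{j:(j,i)\in A} f_{ji}=b_i$ for all $i\in V$ and $l_a\le f_a\le u_a$ for all $a\in A$; the set $\mathcal X$ of these flows is assumed to be non-empty. For $d$ rational cost functions on the arcs, put $c(f)=\bigl(\sum_{a}c^1_af_a,\dots,\sum_a c^d_af_a\bigr)\in\mathbb Q^d$. A flow $f\in\mathcal X$ is *efficient* if no $g\in\mathcal X$ satisfies $c(g)\le c(f)$ componentwise and $c(g)\ne c(f)$. It is *supported efficient* if moreover it minimizes $\lambda^\top c(\cdot)$ over $\mathcal X$ for some $\lambda\in\mathbb R^d$ with all $\lambda_k>0$ and $\sum_k\lambda_k=1$; then $c(f)$ is a *supported nondominated vector*. The *bi-objective minimum cost integer flow problem* (BMCIF) is the case $d=2$. The *all distinct cost value flow problem* (ACVF) asks, for an instance with $d=1$, for flows $f_1,\dots,f_k\in\mathcal X$ with $c(f_1)<\dots<c(f_k)$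 such that $c(g)\in\{c(f_1),\dots,c(f_k)\}$ for every $g\in\mathcal X$. Algorithms are random access machines (integer registers and indirectly addressed arrays; addition, subtraction and halving; unit cost) that terminate on every input; numbers in the input are measured in binary, and rational numbers are given by numerator and denominator. An enumeration problem that assigns to each instance $x$ a finite set $C(x)$ is solved in *output-polynomial time* by an algorithm that on each instance $x$ outputs each element of $C(x)$ exactly once and nothing else, in time polynomial in the encoding length $|x|$ and $|C(x)|$. ACVF is solved in output-polynomial time by an algorithm that on each instance $x$ outputs flows $f_1,\dots,f_k$ as above, each once and in any order, in time polynomial in $|x|$ and $k$. **Theorem.** If all supported nondominated vectors of bi-objective minimum cost integer flow problems can be enumerated in output-polynomial time, then ACVF can be solved in output-polynomial time. Moreover, for every single-objective instance with arc costs $c_a$, consider the BMCIF on the same network with arc cost vectors $(c_a,-c_a)$. The outcome of every feasible flow $f$ is $(c(f),-c(f))$; it is a supported nondominated vector of this BMCIF, and it lies on the line $y_1+y_2=0$. -/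

import Mathlib

/-! ## Random access machines -/

namespace RAM

/-- Words over the integers: inputs and outputs of a random access machine. -/
abbrev Word := List ℤ

/-- Encoding length of a word: every integer is written in binary,
with one additional symbol for its sign. -/
def Word.size (w : Word) : ℕ := (w.map fun z => z.natAbs.size + 1).sum

/-- Programs of a random access machine with integer registers `x, y, z` and integer arrays `a`
whose cells are addressed indirectly, through the content of a register.
The control flow is structured: a conditional and a loop, both of which test whether
a register is positive. -/
inductive Program : Type
  /-- `x := k` -/
  | const (x : ℕ) (k : ℤ)
  /-- `x := y` -/
  | copy (x y : ℕ)
  /-- `x := y + z` -/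
  | add (x y z : ℕ)
  /-- `x := y - z` -/
  | sub (x y z : ℕ)
  /-- `x := ⌊y / 2⌋` -/
  | half (x y : ℕ)
  /-- `x := a[y]` -/
  | load (x a y : ℕ)
  /-- `a[y] := x` -/
  | store (a y x : ℕ)
  /-- append the content of `x` to the word that is being written -/
  | write (x : ℕ)
  /-- output the word written so far, and begin a new, empty one -/
  | emit
  /-- do nothing -/
  | skip
  /-- first `p`, then `q` -/
  | seq (p q : Program)
  /-- `if x > 0 then p else q` -/
  | ifPos (x : ℕ) (p q : Program)
  /-- `while x > 0 do p` -/
  | whilePos (x : ℕ) (p : Program)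

/-- Memory content and output of a random access machine. -/
structure State where
  /-- the registers -/
  reg : ℕ → ℤ
  /-- the arrays; `arr a i` is cell `i` of array `a` -/
  arr : ℕ → ℤ → ℤ
  /-- the word that is being written -/
  current : Word
  /-- the words that have been output, in the order of their output -/
  out : List Word

/-- The initial state on input `w`: array `0` holds `w`, register `0` holds the number of
its entries, and all other cells and registers are zero. -/
def State.init (w : Word) : State where
  reg x := if x = 0 then (w.length : ℤ) else 0
  arr a i := if a = 0 ∧ 0 ≤ i then w.getD i.toNat 0 else 0
  current := []
  out := []

/-- The state after writing `v` into register `x`. -/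
def State.setReg (s : State) (x : ℕ) (v : ℤ) : State :=
  { s with reg := Function.update s.reg x v }

/-- The state after writing `v` into cell `i` of array `a`. -/
def State.setArr (s : State) (a : ℕ) (i v : ℤ) : State :=
  { s with arr := Function.update s.arr a (Function.update (s.arr a) i v) }

/-- `Exec p s t s'`: the program `p`, started in state `s`, terminates after exactly `t` steps,
in state `s'`. Each basic instruction and each test costs one step. (Since there is no
multiplication, `t` steps lengthen the binary representation of the largest number by at
most `t + O(1)` bits, so that unit cost is a realistic measure.) -/
inductive Exec : Program → State → ℕ → State → Prop
  | const (s : State) (x : ℕ) (k : ℤ) : Exec (.const x k) s 1 (s.setReg x k)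
  | copy (s : State) (x y : ℕ) : Exec (.copy x y) s 1 (s.setReg x (s.reg y))
  | add (s : State) (x y z : ℕ) : Exec (.add x y z) s 1 (s.setReg x (s.reg y + s.reg z))
  | sub (s : State) (x y z : ℕ) : Exec (.sub x y z) s 1 (s.setReg x (s.reg y - s.reg z))
  | half (s : State) (x y : ℕ) : Exec (.half x y) s 1 (s.setReg x (s.reg y / 2))
  | load (s : State) (x a y : ℕ) : Exec (.load x a y) s 1 (s.setReg x (s.arr a (s.reg y)))
  | store (s : State) (a y x : ℕ) : Exec (.store a y x) s 1 (s.setArr a (s.reg y) (s.reg x))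
  | write (s : State) (x : ℕ) :
      Exec (.write x) s 1 { s with current := s.current ++ [s.reg x] }
  | emit (s : State) : Exec .emit s 1 { s with current := [], out := s.out ++ [s.current] }
  | skip (s : State) : Exec .skip s 1 s
  | seq {p q : Program} {s₀ s₁ s₂ : State} {t₁ t₂ : ℕ}
      (hp : Exec p s₀ t₁ s₁) (hq : Exec q s₁ t₂ s₂) : Exec (.seq p q) s₀ (t₁ + t₂) s₂
  | ifPos_true {x : ℕ} {p q : Program} {s s' : State} {t : ℕ}
      (hx : 0 < s.reg x) (hp : Exec p s t s') : Exec (.ifPos x p q) s (t + 1) s'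
  | ifPos_false {x : ℕ} {p q : Program} {s s' : State} {t : ℕ}
      (hx : ¬ 0 < s.reg x) (hq : Exec q s t s') : Exec (.ifPos x p q) s (t + 1) s'
  | whilePos_true {x : ℕ} {p : Program} {s₀ s₁ s₂ : State} {t₁ t₂ : ℕ}
      (hx : 0 < s₀.reg x) (hp : Exec p s₀ t₁ s₁) (hw : Exec (.whilePos x p) s₁ t₂ s₂) :
      Exec (.whilePos x p) s₀ (t₁ + t₂ + 1) s₂
  | whilePos_false {x : ℕ} {p : Program} {s : State}
      (hx : ¬ 0 < s.reg x) : Exec (.whilePos x p) s 1 s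

/-- On input `w`, the program `p` terminates after exactly `t` steps and has output
the list of words `out`. -/
def Runs (p : Program) (w : Word) (t : ℕ) (out : List Word) : Prop :=
  ∃ s : State, Exec p (State.init w) t s ∧ s.out = out

/-- A problem with instances in `ι`, encoded by `enc`, for which `Valid x out` says that
the list of words `out` is a correct output on the instance `x`, is solvable in output-polynomial
time: some program terminates on every input and, on every instance, gives a correct output in
a time that is polynomial in the encoding length of the instance and the number of output words. -/
def SolvableInOutputPolyTime {ι : Type} (enc : ι → Word) (Valid : ι → List Word → Prop) : Prop :=
  ∃ p : Program,
    (∀ w : Word, ∃ (t : ℕ) (out : List Word), Runs p w t out) ∧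
    ∃ c k : ℕ, ∀ x : ι, ∃ (t : ℕ) (out : List Word),
      Runs p (enc x) t out ∧ Valid x out ∧ t ≤ c * ((enc x).size + out.length + 1) ^ k

/-- The enumeration problem with instances in `ι`, encoded by `enc`, and configurations `C x`
is solvable in output-polynomial time: each configuration of `x` is output exactly once, and nothing
else is output, in a time that is polynomial in the length of `x` and the cardinality of `C x`. -/
def EnumerableInOutputPolyTime {ι : Type} (enc : ι → Word) (C : ι → Set Word) : Prop :=
  SolvableInOutputPolyTime enc fun x out => out.Nodup ∧ ∀ w : Word, w ∈ out ↔ w ∈ C x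

end RAM

/-! ## Minimum cost integer flow problems -/

/-- A directed graph with nodes `Fin n` and arcs `Fin m` (no two of them parallel),
with flow balances of the nodes and with lower and upper capacities of the arcs. -/
structure FlowNetwork where
  n : ℕ
  m : ℕ
  tail : Fin m → Fin n
  head : Fin m → Fin n
  arc_injective : Function.Injective fun a => (tail a, head a)
  balance : Fin n → ℤ
  lower : Fin m → ℕ
  upper : Fin m → ℕ

namespace FlowNetwork

/-- Feasible integer flows. Nonnegativity follows from that of the lower capacities. -/
def IsFeasible (N : FlowNetwork) (f : Fin N.m → ℤ) : Prop :=
  (∀ i : Fin N.n,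
    ∑ a with N.tail a = i, f a - ∑ a with N.head a = i, f a = N.balance i) ∧
  ∀ a : Fin N.m, (N.lower a : ℤ) ≤ f a ∧ f a ≤ (N.upper a : ℤ)

/-- The underlying undirected graph. -/
def underlyingGraph (N : FlowNetwork) : SimpleGraph (Fin N.n) :=
  SimpleGraph.fromRel fun i j => ∃ a : Fin N.m, N.tail a = i ∧ N.head a = j

/-- The directed graph is connected, and there is at least one feasible flow. -/
def IsAdmissible (N : FlowNetwork) : Prop :=
  N.underlyingGraph.Connected ∧ ∃ f : Fin N.m → ℤ, N.IsFeasible f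

end FlowNetwork

/-- The data of a minimum cost integer flow problem with `d` objectives; `cost k a` is the cost
of the arc `a` in the `k`-th objective. -/
structure MCIF (d : ℕ) extends FlowNetwork where
  cost : Fin d → Fin m → ℚ

namespace MCIF

variable {d : ℕ}

/-- The outcome vector of a flow. -/
def outcome (P : MCIF d) (f : Fin P.m → ℤ) : Fin d → ℚ :=
  fun k => ∑ a, P.cost k a * (f a : ℚ)

/-- Efficient flows: feasible, and not dominated by any feasible flow. -/
def IsEfficient (P : MCIF d) (f : Fin P.m → ℤ) : Prop :=
  P.IsFeasible f ∧
    ¬ ∃ g : Fin P.m → ℤ, P.IsFeasible g ∧ P.outcome g ≤ P.outcome f ∧ P.outcome g ≠ P.outcome f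

/-- Supported efficient flows: efficient, and optimal for a weighted sum scalarization with
strictly positive normalized weights. -/
def IsSupportedEfficient (P : MCIF d) (f : Fin P.m → ℤ) : Prop :=
  P.IsEfficient f ∧
    ∃ w : Fin d → ℝ, (∀ k, 0 < w k) ∧ ∑ k, w k = 1 ∧
      ∀ g : Fin P.m → ℤ, P.IsFeasible g →
        ∑ k, w k * (P.outcome f k : ℝ) ≤ ∑ k, w k * (P.outcome g k : ℝ)

/-- The set of supported nondominated vectors. -/
def supportedNondominated (P : MCIF d) : Set (Fin d → ℚ) :=
  {y | ∃ f : Fin P.m → ℤ, P.IsSupportedEfficient f ∧ P.outcome f = y}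

/-- Rational numbers are encoded by numerator and denominator, in lowest terms. -/
def encodeRat (q : ℚ) : RAM.Word := [q.num, (q.den : ℤ)]

/-- Encoding of outcome vectors. -/
def encodeVector (y : Fin d → ℚ) : RAM.Word := (List.ofFn y).flatMap encodeRat

/-- Encoding of flows. -/
def encodeFlow {m : ℕ} (f : Fin m → ℤ) : RAM.Word := List.ofFn f

/-- Encoding of problem data: the numbers of nodes and arcs, the balances of the nodes, and
for each arc its tail, its head, its lower and upper capacity and its costs. -/
def encode (P : MCIF d) : RAM.Word :=
  [(P.n : ℤ), (P.m : ℤ)] ++ List.ofFn P.balance ++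
    (List.finRange P.m).flatMap fun a =>
      [((P.tail a : ℕ) : ℤ), ((P.head a : ℕ) : ℤ), (P.lower a : ℤ), (P.upper a : ℤ)] ++
        encodeVector fun k => P.cost k a

/-- The instances of the minimum cost integer flow problem with `d` objectives. -/
def Instance (d : ℕ) : Type := {P : MCIF d // P.IsAdmissible}

/-- Encoding of instances. -/
def Instance.encode (P : Instance d) : RAM.Word := P.1.encode

/-- All supported nondominated vectors of bi-objective minimum cost integer flow problems can be
enumerated in output-polynomial time. -/
def SupportedNondominatedEnumerable : Prop :=
  RAM.EnumerableInOutputPolyTime (Instance.encode (d := 2))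
    fun P => encodeVector '' P.1.supportedNondominated

/-- The flows `f₁, …, f_k` in the list `fs` are a solution of the all distinct cost value flow
problem: they are feasible, `c(f₁) < … < c(f_k)`, and every cost of a feasible flow is
among these values. -/
def IsAllDistinctCostFlows (P : MCIF 1) (fs : List (Fin P.m → ℤ)) : Prop :=
  (∀ f ∈ fs, P.IsFeasible f) ∧
  fs.Pairwise (fun f g => P.outcome f 0 < P.outcome g 0) ∧
  ∀ g : Fin P.m → ℤ, P.IsFeasible g → ∃ f ∈ fs, P.outcome f 0 = P.outcome g 0

/-- The all distinct cost value flow problem (ACVF) can be solved in output-polynomial time.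
The flows of a solution may be output in any order. -/
def ACVFSolvable : Prop :=
  RAM.SolvableInOutputPolyTime (Instance.encode (d := 1))
    fun P out => ∃ fs : List (Fin P.1.m → ℤ),
      P.1.IsAllDistinctCostFlows fs ∧ out.Perm (fs.map encodeFlow)

/-- The bi-objective problem on the same network with cost vectors `(c_a, -c_a)`. -/
def opposite (P : MCIF 1) : MCIF 2 where
  toFlowNetwork := P.toFlowNetwork
  cost := ![fun a => P.cost 0 a, fun a => - P.cost 0 a]

end MCIF

namespace RAM

/-! ### Determinism -/

/-! For arc costs `(c, -c)` no two distinct outcomes are comparable, and the weights `(1/2, 1/2)`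
make the scalarization constantly zero. Hence every feasible flow is supported efficient, and the
supported nondominated vectors correspond bijectively to the distinct values of `c`. This settles
the second claim; the assumed enumerator thus lists all cost values.

ACVF also asks for a flow of each value `r`, which is recovered by self-reduction. Capacities `lo`,
`up` are maintained for which some flow has cost `r`, and the interval of one arc after another is
bisected. The lower half may be kept exactly when `r` occurs among the values of the problem
restricted to it. The enumerator is only known to be correct on feasible instances, so feasibility
of the lower half is tested beforehand. For this both objectives are set to the flow on the arc, so
that the unique supported nondominated vector gives the minimum flow there; the lower half is
feasible iff this minimum does not exceed the midpoint. Restriction only removes values, so each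
query has at most as many answers as the original problem. The number of queries per value is at
most twice the number of arcs times the bit length of the capacities. These facts are in
`oracle_of_enumeration`, `bisect_spec`, `fixArc_spec` and `main_spec`.

The rest turns this into an actual machine. The enumerator is simulated inside the reduction
(`Guest.exec_run`). Clearing its memory between runs would require knowing which cells were used;
instead cells carry version numbers. The reduction is written in the language `Cmd`, which has a
functional semantics `eval` and a step count `cost`; `Cmd.exec_compile` transfers both to the
machine. Since loops are counted and the enumerator halts on every word, so does the reduction. -/

theorem Exec.deterministic {p : Program} {s s₁ : State} {t₁ : ℕ} (h : Exec p s t₁ s₁) :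
    ∀ {t₂ : ℕ} {s₂ : State}, Exec p s t₂ s₂ → t₁ = t₂ ∧ s₁ = s₂ := by
  induction h with
  | seq _ _ ih₁ ih₂ =>
    intro _ _ h
    cases h with
    | seq a b =>
      obtain ⟨rfl, rfl⟩ := ih₁ a
      obtain ⟨rfl, rfl⟩ := ih₂ b
      exact ⟨rfl, rfl⟩
  | ifPos_true hx _ ih =>
    intro _ _ h
    cases h with
    | ifPos_true _ a =>
      obtain ⟨rfl, rfl⟩ := ih a
      exact ⟨rfl, rfl⟩
    | ifPos_false hx' _ => exact absurd hx hx'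
  | ifPos_false hx _ ih =>
    intro _ _ h
    cases h with
    | ifPos_true hx' _ => exact absurd hx' hx
    | ifPos_false _ a =>
      obtain ⟨rfl, rfl⟩ := ih a
      exact ⟨rfl, rfl⟩
  | whilePos_true hx _ _ ih₁ ih₂ =>
    intro _ _ h
    cases h with
    | whilePos_true _ a b =>
      obtain ⟨rfl, rfl⟩ := ih₁ a
      obtain ⟨rfl, rfl⟩ := ih₂ b
      exact ⟨rfl, rfl⟩
    | whilePos_false hx' => exact absurd hx hx'
  | whilePos_false hx =>
    intro _ _ h
    cases h with
    | whilePos_true hx' _ _ => exact absurd hx' hx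
    | whilePos_false _ => exact ⟨rfl, rfl⟩
  | _ => intro _ _ h; cases h; exact ⟨rfl, rfl⟩

/-! ### State updates, and words viewed as array contents. -/

@[simp] theorem State.setReg_reg (s : State) (x : ℕ) (v : ℤ) (y : ℕ) :
    (s.setReg x v).reg y = if y = x then v else s.reg y := Function.update_apply ..

@[simp] theorem State.setReg_arr (s : State) (x : ℕ) (v : ℤ) : (s.setReg x v).arr = s.arr := rfl

@[simp] theorem State.setArr_reg (s : State) (a : ℕ) (i v : ℤ) :
    (s.setArr a i v).reg = s.reg := rfl

theorem State.setArr_arr (s : State) (a : ℕ) (i v : ℤ) (b : ℕ) (j : ℤ) :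
    (s.setArr a i v).arr b j = if b = a ∧ j = i then v else s.arr b j := by
  by_cases h : b = a
  · subst h; simp [State.setArr, Function.update_apply]
  · simp [State.setArr, h]

theorem State.setArr_arr_of_ne (s : State) {a b : ℕ} (i v : ℤ) (h : b ≠ a) :
    (s.setArr a i v).arr b = s.arr b := by
  funext j; simp [State.setArr_arr, h]

/-- Cell `i` of the array that holds the word `w`. -/
def Word.cell (w : Word) (i : ℤ) : ℤ := if 0 ≤ i then w.getD i.toNat 0 else 0

theorem Word.cell_natCast (w : Word) (i : ℕ) : w.cell i = w.getD i 0 := by simp [Word.cell]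

@[simp] theorem Word.cell_nil (i : ℤ) : Word.cell [] i = 0 := by simp [Word.cell]

theorem Word.cell_concat (w : Word) (v i : ℤ) :
    Word.cell (w ++ [v]) i = if i = w.length then v else w.cell i := by
  unfold Word.cell
  rcases lt_or_ge i 0 with h | h
  · rw [if_neg (by omega), if_neg (by omega), if_neg (by omega)]
  · lift i to ℕ using h
    simp only [Int.natCast_nonneg, if_true, Int.toNat_natCast, Nat.cast_inj]
    rcases lt_trichotomy i w.length with h | h | h
    · rw [if_neg (by omega), List.getD_append _ _ _ _ h]
    · subst h; simp
    · rw [if_neg (by omega), List.getD_eq_default _ _ (by simp; omega),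
        List.getD_eq_default _ _ (by omega)]

/-! ### Running a program inside another one

The registers of the machine are divided into three classes: those of the host program, the counters
of its loops, and the registers used for the guest program. Each array of the guest has a companion
that records for each cell the version in which it was last written; cells with an
old version count as zero, so that the memory of the guest is cleared by a change of version. -/

namespace Guest

/-- current version of the memory of the guest -/
abbrev ver : ℕ := 2
/-- version of the memory in which the output of the last run is found -/
abbrev resVer : ℕ := 5
/-- number of integers written by the guest -/
abbrev written : ℕ := 8
/-- number of words output by the guest -/
abbrev emitted : ℕ := 11
/-- number of words output in the last run -/
abbrev resCount : ℕ := 14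
/-- scratch register -/
abbrev tmp : ℕ := 17
/-- scratch register -/
abbrev tmp₂ : ℕ := 20
/-- scratch register -/
abbrev tmp₃ : ℕ := 23
/-- registers of the guest -/
abbrev reg (x : ℕ) : ℕ := 3 * x + 26
/-- content of a versioned array -/
abbrev data (a : ℕ) : ℕ := 3 * a + 1
/-- versions of the cells of a versioned array -/
abbrev tag (a : ℕ) : ℕ := 3 * a + 2

/-- Content of a versioned array with respect to the version in register `V`. -/
def read (s : State) (V a : ℕ) (i : ℤ) : ℤ :=
  if s.arr (tag a) i = s.reg V then s.arr (data a) i else 0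

/-- `x := a[y]` for a versioned array -/
def load (V x a y : ℕ) : Program :=
  .seq (.load tmp (tag a) y) <| .seq (.sub tmp V tmp) <|
    .ifPos tmp (.const x 0) (.load x (data a) y)

/-- `a[y] := x` for a versioned array -/
def store (a y x : ℕ) : Program := .seq (.store (data a) y x) (.store (tag a) y ver)

/-- `x := x + 1` -/
def incr (x : ℕ) : Program := .seq (.const tmp 1) (.add x x tmp)

theorem ver_ne_reg (x : ℕ) : ver ≠ reg x := by change 2 ≠ 3 * x + 26; omega
theorem written_ne_reg (x : ℕ) : written ≠ reg x := by change 8 ≠ 3 * x + 26; omega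
theorem emitted_ne_reg (x : ℕ) : emitted ≠ reg x := by change 11 ≠ 3 * x + 26; omega
theorem tmp_ne_reg (x : ℕ) : tmp ≠ reg x := by change 17 ≠ 3 * x + 26; omega

/-- The program that runs the guest. Array `0` collects its output. -/
def run : Program → Program
  | .const x k => .const (reg x) k
  | .copy x y => .copy (reg x) (reg y)
  | .add x y z => .add (reg x) (reg y) (reg z)
  | .sub x y z => .sub (reg x) (reg y) (reg z)
  | .half x y => .half (reg x) (reg y)
  | .load x a y => load ver (reg x) (a + 1) (reg y)
  | .store a y x => store (a + 1) (reg y) (reg x)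
  | .write x => .seq (store 0 written (reg x)) (incr written)
  | .emit => incr emitted
  | .skip => .skip
  | .seq p q => .seq (run p) (run q)
  | .ifPos x p q => .ifPos (reg x) (run p) (run q)
  | .whilePos x p => .whilePos (reg x) (run p)

/-- A strict upper bound for the registers that occur in a program. -/
def bound : Program → ℕ
  | .const x _ => x + 1
  | .copy x y => x + y + 1
  | .add x y z => x + y + z + 1
  | .sub x y z => x + y + z + 1
  | .half x y => x + y + 1
  | .load x _ y => x + y + 1
  | .store _ y x => x + y + 1
  | .write x => x + 1
  | .emit => 0
  | .skip => 0
  | .seq p q => bound p + bound q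
  | .ifPos x p q => x + 1 + bound p + bound q
  | .whilePos x p => x + 1 + bound p

/-- The state `s` of the machine represents the state `v` of the guest. -/
structure Rep (B : ℕ) (s v : State) : Prop where
  reg : ∀ x < B, s.reg (reg x) = v.reg x
  arr : ∀ a i, read s ver (a + 1) i = v.arr a i
  buf : ∀ i, read s ver 0 i = Word.cell (v.out.flatten ++ v.current) i
  tag_le : ∀ a i, s.arr (tag a) i ≤ s.reg ver
  written : s.reg written = (v.out.flatten ++ v.current).length
  emitted : s.reg emitted = v.out.length

/-- The states `s` and `s'` differ only in the part of the memory reserved for the guest. -/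
structure Frame (s s' : State) : Prop where
  reg : ∀ x, x % 3 ≠ 2 → s'.reg x = s.reg x
  ver : s'.reg ver = s.reg ver
  arr : ∀ a, s'.arr (3 * a) = s.arr (3 * a)
  current : s'.current = s.current
  out : s'.out = s.out

theorem Frame.refl (s : State) : Frame s s := ⟨fun _ _ => rfl, rfl, fun _ => rfl, rfl, rfl⟩

theorem Frame.trans {s₁ s₂ s₃ : State} (h : Frame s₁ s₂) (h' : Frame s₂ s₃) : Frame s₁ s₃ :=
  ⟨fun x hx => (h'.reg x hx).trans (h.reg x hx), h'.ver.trans h.ver,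
    fun a => (h'.arr a).trans (h.arr a), h'.current.trans h.current, h'.out.trans h.out⟩

theorem Frame.setReg (s : State) {x : ℕ} (v : ℤ) (hx : x % 3 = 2) (hx' : x ≠ Guest.ver) :
    Frame s (s.setReg x v) where
  reg y hy := by simp only [State.setReg_reg]; rw [if_neg (by rintro rfl; exact hy hx)]
  ver := by simp only [State.setReg_reg]; rw [if_neg (Ne.symm hx')]
  arr _ := rfl
  current := rfl
  out := rfl

theorem read_setReg (s : State) {V x : ℕ} (v : ℤ) (a : ℕ) (i : ℤ) (h : V ≠ x) :
    read (s.setReg x v) V a i = read s V a i := by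
  simp [read, h]

theorem Rep.setReg {B : ℕ} {s v : State} (h : Rep B s v) (x : ℕ) (k : ℤ) :
    Rep B (s.setReg (Guest.reg x) k) (v.setReg x k) where
  reg y hy := by simp [h.reg y hy]
  arr a i := by
    rw [read_setReg _ _ _ _ (ver_ne_reg x)]; exact h.arr a i
  buf i := by
    rw [read_setReg _ _ _ _ (ver_ne_reg x)]; exact h.buf i
  tag_le a i := by
    simp only [State.setReg_reg, State.setReg_arr]
    rw [if_neg (ver_ne_reg x)]
    exact h.tag_le a i
  written := by
    simp only [State.setReg_reg]
    rw [if_neg (written_ne_reg x)]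
    exact h.written
  emitted := by
    simp only [State.setReg_reg]
    rw [if_neg (emitted_ne_reg x)]
    exact h.emitted

/-- Registers that play no role in the representation of the guest. -/
abbrev Free (x : ℕ) : Prop :=
  x % 3 ≠ 2 ∨ x = resVer ∨ x = resCount ∨ x = tmp ∨ x = tmp₂ ∨ x = tmp₃

theorem Rep.setReg_free {B : ℕ} {s v : State} (h : Rep B s v) {x : ℕ} (hx : Free x) (k : ℤ) :
    Rep B (s.setReg x k) v := by
  have key : ∀ y, y = ver ∨ y = Guest.written ∨ y = Guest.emitted ∨ (∃ z, y = Guest.reg z) →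
      (s.setReg x k).reg y = s.reg y := by
    intro y hy
    rw [State.setReg_reg, if_neg]
    rintro rfl
    unfold Free at hx
    have key : ∀ z, 3 * z + 26 ≠ resVer ∧ 3 * z + 26 ≠ resCount ∧ 3 * z + 26 ≠ tmp ∧
        3 * z + 26 ≠ tmp₂ ∧ 3 * z + 26 ≠ tmp₃ := fun z => by
      change 3 * z + 26 ≠ 5 ∧ 3 * z + 26 ≠ 14 ∧ 3 * z + 26 ≠ 17 ∧ 3 * z + 26 ≠ 20 ∧ 3 * z + 26 ≠ 23
      omega
    rcases hy with rfl | rfl | rfl | ⟨z, rfl⟩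
    · revert hx; decide
    · revert hx; decide
    · revert hx; decide
    · have := key z
      have h' : Guest.reg z % 3 = 2 := by change (3 * z + 26) % 3 = 2; omega
      simp only [h', ne_eq, not_true_eq_false, false_or] at hx
      tauto
  refine ⟨fun y hy => ?_, fun a i => ?_, fun i => ?_, fun a i => ?_, ?_, ?_⟩
  · rw [key _ (by simp)]; exact h.reg y hy
  · rw [read, key _ (by simp)]; exact h.arr a i
  · rw [read, key _ (by simp)]; exact h.buf i
  · rw [key _ (by simp)]; exact h.tag_le a i
  · rw [key _ (by simp)]; exact h.written
  · rw [key _ (by simp)]; exact h.emitted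

/-- The machine can only test positivity. As no tag exceeds the version, `V - tag > 0` is equivalent
to the cell being stale, so one subtraction and one test suffice. -/
theorem exec_load (s : State) (V x a y : ℕ) (hV : V ≠ tmp) (hy : y ≠ tmp)
    (h : s.arr (tag a) (s.reg y) ≤ s.reg V) :
    ∃ t k, t ≤ 4 ∧
      Exec (load V x a y) s t ((s.setReg tmp k).setReg x (read s V a (s.reg y))) := by
  have e₁ := Exec.load s tmp (tag a) y
  have e₂ := Exec.sub (s.setReg tmp (s.arr (tag a) (s.reg y))) tmp V tmp
  set s₂ := ((s.setReg tmp (s.arr (tag a) (s.reg y))).setReg tmp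
    ((s.setReg tmp (s.arr (tag a) (s.reg y))).reg V -
      (s.setReg tmp (s.arr (tag a) (s.reg y))).reg tmp)) with hs₂
  have hs : s₂ = s.setReg tmp (s.reg V - s.arr (tag a) (s.reg y)) := by
    rw [hs₂]; simp [State.setReg, hV]
  have htmp : s₂.reg tmp = s.reg V - s.arr (tag a) (s.reg y) := by rw [hs]; simp
  by_cases hc : s.arr (tag a) (s.reg y) = s.reg V
  · have e₃ := Exec.load s₂ x (data a) y
    rw [show s₂.setReg x (s₂.arr (data a) (s₂.reg y)) =
      (s.setReg tmp (s.reg V - s.arr (tag a) (s.reg y))).setReg x (read s V a (s.reg y)) by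
        rw [hs, read, if_pos hc]; simp [hy]] at e₃
    exact ⟨_, _, by norm_num, .seq e₁ (.seq e₂ (.ifPos_false (by omega) e₃))⟩
  · have e₃ := Exec.const s₂ x 0
    rw [show s₂.setReg x 0 =
      (s.setReg tmp (s.reg V - s.arr (tag a) (s.reg y))).setReg x (read s V a (s.reg y)) by
        rw [hs, read, if_neg hc]] at e₃
    exact ⟨_, _, by norm_num, .seq e₁ (.seq e₂ (.ifPos_true (by omega) e₃))⟩

theorem exec_incr (s : State) (x : ℕ) (hx : x ≠ tmp) :
    Exec (incr x) s 2 ((s.setReg tmp 1).setReg x (s.reg x + 1)) := by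
  have := Exec.seq (Exec.const s tmp 1) (Exec.add (s.setReg tmp 1) x x tmp)
  simpa [incr, hx] using this

/-- The state after `a[i] := k` for a versioned array. -/
def setCell (s : State) (a : ℕ) (i k : ℤ) : State :=
  (s.setArr (data a) i k).setArr (tag a) i (s.reg ver)

theorem exec_store (s : State) (a y x : ℕ) :
    Exec (store a y x) s 2 (setCell s a (s.reg y) (s.reg x)) :=
  .seq (.store s (data a) y x) (.store _ (tag a) y ver)

@[simp] theorem setCell_reg (s : State) (a : ℕ) (i k : ℤ) : (setCell s a i k).reg = s.reg := rfl

theorem setCell_tag (s : State) (a : ℕ) (i k : ℤ) (b : ℕ) (j : ℤ) :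
    (setCell s a i k).arr (tag b) j = if b = a ∧ j = i then s.reg ver else s.arr (tag b) j := by
  simp only [setCell, State.setArr_arr]
  have h₁ : (tag b = tag a) ↔ b = a := by simp [tag]
  have h₂ : ¬ tag b = data a := by change ¬ 3 * b + 2 = 3 * a + 1; omega
  simp [h₂]

theorem read_setCell (s : State) (a : ℕ) (i k : ℤ) (b : ℕ) (j : ℤ) :
    read (setCell s a i k) ver b j = if b = a ∧ j = i then k else read s ver b j := by
  have h₁ : (data b = data a) ↔ b = a := by simp [data]
  have h₂ : ¬ data b = tag a := by change ¬ 3 * b + 1 = 3 * a + 2; omega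
  have h₃ : ¬ data a = tag a := by change ¬ 3 * a + 1 = 3 * a + 2; omega
  rw [read, setCell_tag, setCell_reg]
  by_cases h : b = a ∧ j = i
  · rw [if_pos h, if_pos h, if_pos rfl]
    simp only [setCell, State.setArr_arr, h, h₃, and_true, if_true, if_false]
  · rw [if_neg h, if_neg h, read]
    simp only [setCell, State.setArr_arr, h₁, h, h₂, false_and, if_false]

theorem Frame.setCell (s : State) (a : ℕ) (i k : ℤ) : Frame s (setCell s a i k) where
  reg _ _ := rfl
  ver := rfl
  arr b := by
    rw [Guest.setCell, State.setArr_arr_of_ne _ _ _ (by change 3 * b ≠ 3 * a + 2; omega),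
      State.setArr_arr_of_ne _ _ _ (by change 3 * b ≠ 3 * a + 1; omega)]
  current := rfl
  out := rfl

theorem Rep.setCell {B : ℕ} {s v : State} (h : Rep B s v) (a : ℕ) (i k : ℤ) :
    Rep B (setCell s (a + 1) i k) (v.setArr a i k) where
  reg := h.reg
  arr b j := by rw [read_setCell, State.setArr_arr, h.arr]; simp
  buf j := by rw [read_setCell, if_neg (by omega)]; exact h.buf j
  tag_le b j := by
    rw [setCell_tag, setCell_reg]
    split
    · rfl
    · exact h.tag_le b j
  written := h.written
  emitted := h.emitted

/-- The register `written` holds the length of the buffer, so it addresses the first unused cell and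
the store appends. -/
theorem Rep.write {B : ℕ} {s v : State} (h : Rep B s v) (k : ℤ) :
    Rep B (((Guest.setCell s 0 (s.reg Guest.written) k).setReg tmp 1).setReg Guest.written
      (s.reg Guest.written + 1)) { v with current := v.current ++ [k] } where
  reg x hx := by
    simp only [State.setReg_reg, setCell_reg]
    rw [if_neg (written_ne_reg x).symm, if_neg (tmp_ne_reg x).symm]
    exact h.reg x hx
  arr b j := by
    rw [read_setReg _ _ _ _ (by simp), read_setReg _ _ _ _ (by simp), read_setCell,
      if_neg (by omega)]
    exact h.arr b j
  buf j := by
    rw [read_setReg _ _ _ _ (by simp), read_setReg _ _ _ _ (by simp), read_setCell,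
      ← List.append_assoc, Word.cell_concat, h.buf, h.written]
    simp
  tag_le b j := by
    simp only [State.setReg_reg, State.setReg_arr, setCell_tag, setCell_reg]
    split
    · simp
    · simpa using h.tag_le b j
  written := by simp [h.written, add_assoc]
  emitted := by simp [h.emitted]

/-- Ending a word does not change the concatenation of everything written, so only the word counter
moves. Word boundaries are lost; the reduction can do without them because all words it reads have
the same length. -/
theorem Rep.emit {B : ℕ} {s v : State} (h : Rep B s v) :
    Rep B ((s.setReg tmp 1).setReg Guest.emitted (s.reg Guest.emitted + 1))
      { v with current := [], out := v.out ++ [v.current] } where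
  reg x hx := by
    simp only [State.setReg_reg]
    rw [if_neg (emitted_ne_reg x).symm, if_neg (tmp_ne_reg x).symm]
    exact h.reg x hx
  arr b j := by
    rw [read_setReg _ _ _ _ (by simp), read_setReg _ _ _ _ (by simp)]; exact h.arr b j
  buf j := by
    rw [read_setReg _ _ _ _ (by simp), read_setReg _ _ _ _ (by simp)]
    simpa using h.buf j
  tag_le b j := by simpa using h.tag_le b j
  written := by simpa using h.written
  emitted := by simp [h.emitted]

theorem free_tmp : Free tmp := by decide

theorem frame_setReg_reg (s : State) (x : ℕ) (k : ℤ) : Frame s (s.setReg (reg x) k) :=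
  .setReg s k (by change (3 * x + 26) % 3 = 2; omega) (ver_ne_reg x).symm

theorem frame_setReg_tmp (s : State) (k : ℤ) : Frame s (s.setReg tmp k) :=
  .setReg s k rfl (by decide)

/-- Each guest instruction becomes at most four host steps; versioned loads and `write` attain this.
The bound `B` covers all registers of `p`, so registers outside the representation are never
consulted. -/
theorem exec_run {B : ℕ} {p : Program} {v v' : State} {t : ℕ} (h : Exec p v t v') :
    bound p ≤ B → ∀ {s : State}, Rep B s v →
      ∃ t' s', Exec (run p) s t' s' ∧ t' ≤ 4 * t ∧ Rep B s' v' ∧ Frame s s' := by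
  induction h with
  | const v x k =>
    intro _ s hs
    exact ⟨_, _, .const _ _ _, by omega, hs.setReg x k, frame_setReg_reg ..⟩
  | copy v x y =>
    intro hB s hs
    simp only [bound] at hB
    refine ⟨_, _, .copy _ _ _, by omega, ?_, frame_setReg_reg ..⟩
    rw [hs.reg y (by omega)]; exact hs.setReg ..
  | add v x y z =>
    intro hB s hs
    simp only [bound] at hB
    refine ⟨_, _, .add _ _ _ _, by omega, ?_, frame_setReg_reg ..⟩
    rw [hs.reg y (by omega), hs.reg z (by omega)]; exact hs.setReg ..
  | sub v x y z =>
    intro hB s hs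
    simp only [bound] at hB
    refine ⟨_, _, .sub _ _ _ _, by omega, ?_, frame_setReg_reg ..⟩
    rw [hs.reg y (by omega), hs.reg z (by omega)]; exact hs.setReg ..
  | half v x y =>
    intro hB s hs
    simp only [bound] at hB
    refine ⟨_, _, .half _ _ _, by omega, ?_, frame_setReg_reg ..⟩
    rw [hs.reg y (by omega)]; exact hs.setReg ..
  | load v x a y =>
    intro hB s hs
    simp only [bound] at hB
    obtain ⟨t, k, ht, e⟩ := exec_load s ver (reg x) (a + 1) (reg y) (by simp)
      (tmp_ne_reg y).symm (hs.tag_le _ _)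
    rw [hs.arr, hs.reg y (by omega)] at e
    exact ⟨t, _, e, by omega, (hs.setReg_free free_tmp k).setReg ..,
      (frame_setReg_tmp s k).trans (frame_setReg_reg ..)⟩
  | store v a y x =>
    intro hB s hs
    simp only [bound] at hB
    refine ⟨_, _, exec_store _ _ _ _, by omega, ?_, .setCell ..⟩
    rw [hs.reg y (by omega), hs.reg x (by omega)]; exact hs.setCell ..
  | write v x =>
    intro hB s hs
    simp only [bound] at hB
    refine ⟨_, _, .seq (exec_store _ _ _ _) (exec_incr _ _ (by simp)), by omega, ?_, ?_⟩
    · rw [hs.reg x (by omega)]; exact hs.write _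
    · exact (Frame.setCell ..).trans ((frame_setReg_tmp ..).trans (.setReg _ _ rfl (by decide)))
  | emit v =>
    intro hB s hs
    exact ⟨_, _, exec_incr _ _ (by simp), by omega, hs.emit,
      (frame_setReg_tmp ..).trans (.setReg _ _ rfl (by decide))⟩
  | skip v =>
    intro _ s hs
    exact ⟨_, _, .skip _, by omega, hs, .refl _⟩
  | seq _ _ ih₁ ih₂ =>
    intro hB s hs
    simp only [bound] at hB
    obtain ⟨t₁, s₁, e₁, ht₁, h₁, f₁⟩ := ih₁ (by omega) hs
    obtain ⟨t₂, s₂, e₂, ht₂, h₂, f₂⟩ := ih₂ (by omega) h₁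
    exact ⟨_, _, .seq e₁ e₂, by omega, h₂, f₁.trans f₂⟩
  | ifPos_true hx _ ih =>
    intro hB s hs
    simp only [bound] at hB
    obtain ⟨t₁, s₁, e₁, ht₁, h₁, f₁⟩ := ih (by omega) hs
    exact ⟨_, _, .ifPos_true (by rwa [hs.reg _ (by omega)]) e₁, by omega, h₁, f₁⟩
  | ifPos_false hx _ ih =>
    intro hB s hs
    simp only [bound] at hB
    obtain ⟨t₁, s₁, e₁, ht₁, h₁, f₁⟩ := ih (by omega) hs
    exact ⟨_, _, .ifPos_false (by rwa [hs.reg _ (by omega)]) e₁, by omega, h₁, f₁⟩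
  | whilePos_true hx _ _ ih₁ ih₂ =>
    intro hB s hs
    have hB' := hB
    simp only [bound] at hB
    obtain ⟨t₁, s₁, e₁, ht₁, h₁, f₁⟩ := ih₁ (by omega) hs
    obtain ⟨t₂, s₂, e₂, ht₂, h₂, f₂⟩ := ih₂ hB' h₁
    exact ⟨_, _, .whilePos_true (by rwa [hs.reg _ (by omega)]) e₁ e₂, by omega, h₂, f₁.trans f₂⟩
  | whilePos_false hx =>
    intro hB s hs
    simp only [bound] at hB
    exact ⟨_, _, .whilePos_false (by rwa [hs.reg _ (by omega)]), by omega, hs, .refl _⟩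

end Guest

end RAM

namespace RAM

/-! ### A language for programs with subroutine calls -/

/-- Programs with variables in `V` and arrays in `A` that can call a subroutine. The input of the
subroutine is collected by `push`, and the integers and the number of words that it output in
the last call are read by `result` and `count`. All loops are counted. -/
inductive Cmd (V A : Type) : Type
  | skip
  | const (x : V) (k : ℤ)
  | add (x y z : V)
  | sub (x y z : V)
  | half (x y : V)
  | size (x y : V)
  | load (x : V) (a : A) (y : V)
  | store (a : A) (y x : V)
  | write (x : V)
  | emit
  | push (x : V)
  | call
  | result (x y : V)
  | count (x : V)
  | seq (c d : Cmd V A)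
  | ifPos (x : V) (c d : Cmd V A)
  | ifEq (x y : V) (c d : Cmd V A)
  | loop (x : V) (c : Cmd V A)

/-- Memory content and output of a program with subroutine calls. -/
structure Config (V A : Type) where
  reg : V → ℤ
  arr : A → ℤ → ℤ
  query : Word
  res : Word
  count : ℕ
  current : Word
  out : List Word

variable {V A : Type}

/-- The configuration after writing `k` into the variable `x`. -/
def Config.set [DecidableEq V] (u : Config V A) (x : V) (k : ℤ) : Config V A :=
  { u with reg := Function.update u.reg x k }

/-- The configuration after a call of the subroutine `f`. -/
def Config.call (f : Word → State) (u : Config V A) : Config V A :=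
  { u with
    query := []
    res := (f u.query).out.flatten ++ (f u.query).current
    count := (f u.query).out.length }

namespace Cmd

/-- The result of a command, where `f` maps the inputs of the subroutine to its final states. -/
def eval [DecidableEq V] [DecidableEq A] (f : Word → State) : Cmd V A → Config V A → Config V A
  | skip, u => u
  | const x k, u => u.set x k
  | add x y z, u => u.set x (u.reg y + u.reg z)
  | sub x y z, u => u.set x (u.reg y - u.reg z)
  | half x y, u => u.set x (u.reg y / 2)
  | size x y, u => u.set x ((u.reg y).toNat.size)
  | load x a y, u => u.set x (u.arr a (u.reg y))
  | store a y x, u =>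
    { u with arr := Function.update u.arr a (Function.update (u.arr a) (u.reg y) (u.reg x)) }
  | write x, u => { u with current := u.current ++ [u.reg x] }
  | emit, u => { u with current := [], out := u.out ++ [u.current] }
  | push x, u => { u with query := u.query ++ [u.reg x] }
  | call, u => u.call f
  | result x y, u => u.set x (u.res.cell (u.reg y))
  | count x, u => u.set x u.count
  | seq c d, u => d.eval f (c.eval f u)
  | ifPos x c d, u => if 0 < u.reg x then c.eval f u else d.eval f u
  | ifEq x y c d, u => if u.reg x = u.reg y then c.eval f u else d.eval f u
  | loop x c, u => (c.eval f)^[(u.reg x).toNat] u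

/-- The number of steps of a command, where `τ` is the running time of the subroutine. -/
def cost [DecidableEq V] [DecidableEq A] (f : Word → State) (τ : Word → ℕ) : Cmd V A → Config V A → ℕ
  | size _ y, u => 1 + (u.reg y).toNat.size
  | call, u => 1 + τ u.query
  | seq c d, u => c.cost f τ u + d.cost f τ (c.eval f u)
  | ifPos x c d, u => 1 + if 0 < u.reg x then c.cost f τ u else d.cost f τ u
  | ifEq x y c d, u => 1 + if u.reg x = u.reg y then c.cost f τ u else d.cost f τ u
  | loop x c, u =>
    1 + ∑ i ∈ Finset.range (u.reg x).toNat, (1 + c.cost f τ ((c.eval f)^[i] u))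
  | _, _ => 1

end Cmd

/-! ### Calling convention and compilation of commands. -/

namespace Guest

/-- Reset the registers of the guest. -/
def clear : ℕ → Program
  | 0 => .skip
  | n + 1 => .seq (clear n) (.const (reg n) 0)

/-- Run the guest, make its output available, and prepare the next run. -/
def call (p : Program) : Program :=
  .seq (run p) <| .seq (.copy resVer ver) <| .seq (incr ver) <| .seq (.copy resCount emitted) <|
    .seq (.const emitted 0) <| .seq (.const written 0) (clear (bound p + 1))

/-- registers of the host -/
abbrev var (x : ℕ) : ℕ := 3 * x
/-- counter of a loop at nesting depth `d` -/
abbrev counter (d : ℕ) : ℕ := 3 * d + 1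

/-- `x := size of y` -/
def size (x y : ℕ) : Program :=
  .seq (.copy tmp y) <| .seq (.const tmp₂ 0) <| .seq (.const tmp₃ 1) <|
    .seq (.whilePos tmp (.seq (.half tmp tmp) (.add tmp₂ tmp₂ tmp₃))) (.copy x tmp₂)

end Guest

open Guest in
/-- Translation of commands that call the program `p`; `d` is the nesting depth. -/
def Cmd.compile (p : Program) (cv : V ↪ ℕ) (ca : A ↪ ℕ) : ℕ → Cmd V A → Program
  | _, .skip => .skip
  | _, .const x k => .const (var (cv x)) k
  | _, .add x y z => .add (var (cv x)) (var (cv y)) (var (cv z))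
  | _, .sub x y z => .sub (var (cv x)) (var (cv y)) (var (cv z))
  | _, .half x y => .half (var (cv x)) (var (cv y))
  | _, .size x y => Guest.size (var (cv x)) (var (cv y))
  | _, .load x a y => .load (var (cv x)) (3 * ca a) (var (cv y))
  | _, .store a y x => .store (3 * ca a) (var (cv y)) (var (cv x))
  | _, .write x => .write (var (cv x))
  | _, .emit => .emit
  | _, .push x => .seq (Guest.store 1 (reg 0) (var (cv x))) (incr (reg 0))
  | _, .call => Guest.call p
  | _, .result x y => Guest.load resVer (var (cv x)) 0 (var (cv y))
  | _, .count x => .copy (var (cv x)) resCount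
  | d, .seq c c' => .seq (c.compile p cv ca d) (c'.compile p cv ca d)
  | d, .ifPos x c c' => .ifPos (var (cv x)) (c.compile p cv ca d) (c'.compile p cv ca d)
  | d, .ifEq x y c c' =>
    .seq (.sub tmp (var (cv x)) (var (cv y))) <| .ifPos tmp (c'.compile p cv ca d) <|
      .seq (.sub tmp (var (cv y)) (var (cv x))) <|
        .ifPos tmp (c'.compile p cv ca d) (c.compile p cv ca d)
  | d, .loop x c =>
    .seq (.copy (counter d) (var (cv x))) <| .whilePos (counter d) <|
      .seq (c.compile p cv ca (d + 1)) <| .seq (.const tmp 1) (.sub (counter d) (counter d) tmp)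

/-! ### Correctness and running time of the compiled commands. -/

namespace Guest

theorem exec_clear (n : ℕ) (s : State) : ∃ s', Exec (clear n) s (n + 1) s' ∧
    (∀ x < n, s'.reg (reg x) = 0) ∧ (∀ y, (∀ x, y ≠ reg x) → s'.reg y = s.reg y) ∧
    s'.arr = s.arr ∧ s'.current = s.current ∧ s'.out = s.out := by
  induction n with
  | zero => exact ⟨s, .skip s, by simp⟩
  | succ n ih =>
    obtain ⟨s', e, h₁, h₂, h₃, h₄, h₅⟩ := ih
    refine ⟨_, .seq e (.const _ _ _), fun x hx => ?_, fun y hy => ?_, h₃, h₄, h₅⟩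
    · rw [State.setReg_reg]
      split
      · rfl
      · refine h₁ x ?_
        have : x ≠ n := by rintro rfl; contradiction
        omega
    · rw [State.setReg_reg, if_neg (hy n), h₂ y hy]

theorem size_half {n : ℕ} (h : 0 < n) : n.size = (n / 2).size + 1 := by
  have := Nat.size_bit (b := n.bodd) (n := n.div2) (by rw [Nat.bit_bodd_div2]; omega)
  rwa [Nat.bit_bodd_div2, Nat.div2_val] at this

/-- Each halving shortens the binary representation by one digit (`size_half`) and costs three
steps: test, halving, addition. The induction is on an upper bound for the register, which halves as
well. -/
theorem exec_size_loop : ∀ (n : ℕ) (s : State), s.reg tmp ≤ n → s.reg tmp₃ = 1 →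
    ∃ k, Exec (.whilePos tmp (.seq (.half tmp tmp) (.add tmp₂ tmp₂ tmp₃))) s
      (3 * (s.reg tmp).toNat.size + 1)
      ((s.setReg tmp k).setReg tmp₂ (s.reg tmp₂ + (s.reg tmp).toNat.size)) := by
  intro n
  induction n using Nat.strong_induction_on with
  | _ n ih =>
    intro s hn h₃
    by_cases hs : 0 < s.reg tmp
    · set s₁ := (s.setReg tmp (s.reg tmp / 2)).setReg tmp₂ (s.reg tmp₂ + 1) with hs₁
      have e : Exec (.seq (.half tmp tmp) (.add tmp₂ tmp₂ tmp₃)) s (1 + 1) s₁ := by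
        have := Exec.seq (.half s tmp tmp) (.add (s.setReg tmp (s.reg tmp / 2)) tmp₂ tmp₂ tmp₃)
        simpa [hs₁, h₃] using this
      have htmp : s₁.reg tmp = s.reg tmp / 2 := by simp [hs₁]
      obtain ⟨k, e'⟩ := ih (n / 2) (by omega) s₁ (by rw [htmp]; omega) (by simp [hs₁, h₃])
      refine ⟨k, ?_⟩
      have := Exec.whilePos_true hs e e'
      have hsz : (s.reg tmp).toNat.size = (s₁.reg tmp).toNat.size + 1 := by
        rw [htmp, size_half (n := (s.reg tmp).toNat) (by omega)]
        congr 2; omega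
      rw [show ((s₁.setReg tmp k).setReg tmp₂ (s₁.reg tmp₂ + (s₁.reg tmp).toNat.size)) =
        (s.setReg tmp k).setReg tmp₂ (s.reg tmp₂ + (s.reg tmp).toNat.size) by
          rw [hsz, hs₁]
          simp only [State.setReg, Function.update_self, Nat.cast_add, Nat.cast_one]
          congr 1
          funext y
          simp only [Function.update_apply]
          split_ifs <;> simp_all; ring] at this
      rw [hsz] at this ⊢
      rwa [show 3 * ((s₁.reg tmp).toNat.size + 1) + 1 =
        1 + 1 + (3 * (s₁.reg tmp).toNat.size + 1) + 1 by ring]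
    · refine ⟨s.reg tmp, ?_⟩
      have := Exec.whilePos_false (p := .seq (.half tmp tmp) (.add tmp₂ tmp₂ tmp₃)) hs
      rw [show (s.reg tmp).toNat = 0 by omega]
      simpa [State.setReg] using this

theorem exec_size (s : State) (x y : ℕ) : ∃ k k₃,
    Exec (size x y) s (3 * (s.reg y).toNat.size + 5)
      ((((s.setReg tmp k).setReg tmp₂ (s.reg y).toNat.size).setReg tmp₃ k₃).setReg x
        (s.reg y).toNat.size) := by
  set s₁ := ((s.setReg tmp (s.reg y)).setReg tmp₂ 0).setReg tmp₃ 1 with hs₁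
  have htmp : s₁.reg tmp = s.reg y := by simp [hs₁]
  obtain ⟨k, e⟩ := exec_size_loop (s.reg y).toNat s₁ (by rw [htmp]; omega) (by simp [hs₁])
  refine ⟨k, 1, ?_⟩
  have := Exec.seq (.copy s tmp y) <| .seq (.const _ tmp₂ 0) <| .seq (.const _ tmp₃ 1) <|
    .seq e (.copy _ x tmp₂)
  rw [show ((s₁.setReg tmp k).setReg tmp₂ (s₁.reg tmp₂ + (s₁.reg tmp).toNat.size)) =
      ((s.setReg tmp k).setReg tmp₂ (s.reg y).toNat.size).setReg tmp₃ 1 by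
        rw [htmp, hs₁]
        simp only [State.setReg]
        congr 1
        funext y
        simp only [Function.update_apply]
        split_ifs <;> simp_all] at this
  rw [htmp, show ((((s.setReg tmp k).setReg tmp₂ (s.reg y).toNat.size).setReg tmp₃ 1).reg tmp₂) =
    (s.reg y).toNat.size by simp] at this
  rwa [show 3 * (s.reg y).toNat.size + 5 =
    1 + (1 + (1 + (3 * (s.reg y).toNat.size + 1 + 1))) by ring]

variable (p : Program) (cv : V ↪ ℕ) (ca : A ↪ ℕ)

/-- The state `s` of the machine represents the configuration `u`. -/
structure HostRep (s : State) (u : Config V A) : Prop where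
  reg : ∀ x, s.reg (var (cv x)) = u.reg x
  arr : ∀ a, s.arr (3 * ca a) = u.arr a
  guest : Rep (bound p + 1) s (State.init u.query)
  res : ∀ i, read s resVer 0 i = u.res.cell i
  tag_le : ∀ i, s.arr (tag 0) i ≤ s.reg resVer
  ver_lt : s.reg resVer < s.reg ver
  count : s.reg resCount = u.count
  current : s.current = u.current
  out : s.out = u.out

variable {p cv ca}

theorem HostRep.setReg_free {s : State} {u : Config V A} (h : HostRep p cv ca s u) {x : ℕ}
    (hx : x % 3 = 1 ∨ x = tmp ∨ x = tmp₂ ∨ x = tmp₃) (k : ℤ) :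
    HostRep p cv ca (s.setReg x k) u := by
  have hres : (s.setReg x k).reg resVer = s.reg resVer := by
    rw [State.setReg_reg, if_neg]; rintro rfl; revert hx; decide
  have hver : (s.setReg x k).reg ver = s.reg ver := by
    rw [State.setReg_reg, if_neg]; rintro rfl; revert hx; decide
  refine ⟨fun y => ?_, h.arr, h.guest.setReg_free ?_ k, fun i => ?_, fun i => ?_, ?_, ?_,
    h.current, h.out⟩
  · rw [State.setReg_reg, if_neg, h.reg]
    rintro rfl
    have : ∀ z, 3 * z % 3 ≠ 1 ∧ 3 * z ≠ 17 ∧ 3 * z ≠ 20 ∧ 3 * z ≠ 23 := by omega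
    have := this (cv y)
    rcases hx with hx | hx | hx | hx
    · exact this.1 hx
    · exact this.2.1 hx
    · exact this.2.2.1 hx
    · exact this.2.2.2 hx
  · rcases hx with hx | hx | hx | hx
    · left; omega
    all_goals simp [Free, hx]
  · rw [read, hres]; exact h.res i
  · rw [hres]; exact h.tag_le i
  · rw [hres, hver]; exact h.ver_lt
  · rw [State.setReg_reg, if_neg, h.count]
    rintro rfl; revert hx; decide

theorem var_ne {x y : ℕ} (hy : y % 3 ≠ 0) : y ≠ var x := by
  rintro rfl; exact hy (Nat.mul_mod_right 3 x)

theorem HostRep.set [DecidableEq V] {s : State} {u : Config V A} (h : HostRep p cv ca s u) (x : V) (k : ℤ) :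
    HostRep p cv ca (s.setReg (var (cv x)) k) (u.set x k) where
  reg y := by
    simp only [State.setReg_reg, Config.set, Function.update_apply, h.reg]
    simp
  arr := h.arr
  guest := h.guest.setReg_free (by left; rw [show var (cv x) % 3 = 0 from Nat.mul_mod_right 3 _]; decide) k
  res i := by rw [read_setReg _ _ _ _ (var_ne (by decide))]; exact h.res i
  tag_le i := by rw [State.setReg_reg, if_neg (var_ne (by decide))]; exact h.tag_le i
  ver_lt := by
    rw [State.setReg_reg, if_neg (var_ne (by decide)), State.setReg_reg,
      if_neg (var_ne (by decide))]
    exact h.ver_lt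
  count := by rw [State.setReg_reg, if_neg (var_ne (by decide))]; exact h.count
  current := h.current
  out := h.out

/-- Host arrays have numbers divisible by 3, while contents and tags of the guest arrays have
residues 1 and 2, so the guest is not disturbed. -/
theorem HostRep.store [DecidableEq A] {s : State} {u : Config V A} (h : HostRep p cv ca s u) (a : A) (i k : ℤ) :
    HostRep p cv ca (s.setArr (3 * ca a) i k)
      { u with arr := Function.update u.arr a (Function.update (u.arr a) i k) } := by
  have hd : ∀ b, (s.setArr (3 * ca a) i k).arr (data b) = s.arr (data b) := fun b =>
    State.setArr_arr_of_ne _ _ _ (by change 3 * b + 1 ≠ _; omega)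
  have ht : ∀ b, (s.setArr (3 * ca a) i k).arr (tag b) = s.arr (tag b) := fun b =>
    State.setArr_arr_of_ne _ _ _ (by change 3 * b + 2 ≠ _; omega)
  refine ⟨h.reg, fun b => ?_, ⟨h.guest.reg, fun b j => ?_, fun j => ?_, fun b j => ?_,
    h.guest.written, h.guest.emitted⟩, fun j => ?_, fun j => ?_, h.ver_lt, h.count,
    h.current, h.out⟩
  · funext j
    rw [State.setArr_arr, h.arr]
    by_cases hb : b = a
    · subst hb; simp [Function.update_apply]
    · simp [hb]
  · rw [read, hd, ht]; exact h.guest.arr b j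
  · rw [read, hd, ht]; exact h.guest.buf j
  · rw [ht]; exact h.guest.tag_le b j
  · rw [read, hd, ht]; exact h.res j
  · rw [ht]; exact h.tag_le j

/-- Extending the input by one entry changes one cell and the length register. A query can therefore
be built directly in the guest's memory, which at all times represents the initial state for the
part pushed so far. -/
theorem init_concat (w : Word) (k : ℤ) :
    State.init (w ++ [k]) = ((State.init w).setArr 0 w.length k).setReg 0 (w.length + 1) := by
  have harr : ∀ (w : Word) a i, (State.init w).arr a i = if a = 0 then w.cell i else 0 := by
    intro w a i
    simp only [State.init, Word.cell]
    split_ifs <;> simp_all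
  have : (State.init (w ++ [k])).arr = ((State.init w).setArr 0 w.length k).arr := by
    funext a i
    rw [State.setArr_arr, harr, harr, Word.cell_concat]
    split_ifs <;> simp_all
  have hreg : (State.init (w ++ [k])).reg =
      (((State.init w).setArr 0 w.length k).setReg 0 (w.length + 1)).reg := by
    funext x
    simp [State.init]
    split_ifs <;> rfl
  have ext : ∀ s s' : State, s.reg = s'.reg → s.arr = s'.arr → s.current = s'.current →
      s.out = s'.out → s = s' := by
    rintro ⟨⟩ ⟨⟩; simp_all
  exact ext _ _ hreg this rfl rfl

theorem Rep.push {B : ℕ} {s : State} {w : Word} (h : Rep B s (State.init w)) (hB : 0 < B) (k : ℤ) :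
    Rep B (((Guest.setCell s 1 (s.reg (Guest.reg 0)) k).setReg tmp 1).setReg (Guest.reg 0)
      (s.reg (Guest.reg 0) + 1)) (State.init (w ++ [k])) := by
  rw [h.reg 0 hB, init_concat]
  exact ((h.setCell 0 _ _).setReg_free free_tmp 1).setReg 0 _

/-- All tags are at most the version of the finished run, so incrementing the version makes every
cell read as zero and the guest is back at the empty input. The output remains readable through the
old version kept in `resVer`. Clearing `bound p + 1` registers ensures that register 0, the length
of the query, is among them. -/
theorem exec_call {f : Word → State} {τ : Word → ℕ}
    (hf : ∀ w, Exec p (State.init w) (τ w) (f w)) {s : State} {u : Config V A}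
    (h : HostRep p cv ca s u) :
    ∃ t s', Exec (Guest.call p) s t s' ∧ t ≤ 4 * τ u.query + bound p + 10 ∧
      HostRep p cv ca s' (u.call f) ∧ ∀ x, x % 3 ≠ 2 → s'.reg x = s.reg x := by
  obtain ⟨t, s₁, e₁, ht, h₁, f₁⟩ := exec_run (hf u.query) (Nat.le_succ _) h.guest
  set s₂ := (s₁.setReg resVer (s₁.reg ver)).setReg tmp 1 with hs₂
  set s₃ := ((((s₂.setReg ver (s₁.reg ver + 1)).setReg resCount (s₁.reg emitted)).setReg
    emitted 0).setReg written 0) with hs₃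
  obtain ⟨s₄, e₄, hr, hr', harr, hcur, hout⟩ := exec_clear (bound p + 1) s₃
  have hreg : ∀ y, y % 3 ≠ 2 → s₄.reg y = s₁.reg y := by
    intro y hy
    rw [hr' y (by rintro x rfl; exact hy (by change (3 * x + 26) % 3 = 2; omega))]
    have : ∀ z, z % 3 = 2 → y ≠ z := by rintro z hz rfl; exact hy hz
    simp only [hs₃, hs₂, State.setReg_reg]
    rw [if_neg (this _ rfl), if_neg (this _ rfl), if_neg (this _ rfl), if_neg (this _ rfl),
      if_neg (this _ rfl), if_neg (this _ rfl)]
  have hver : s₄.reg ver = s₁.reg ver + 1 := by rw [hr' _ ver_ne_reg]; simp [hs₃]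
  have hresVer : s₄.reg resVer = s₁.reg ver := by
    rw [hr' _ (fun x => by change 5 ≠ 3 * x + 26; omega)]; simp [hs₃, hs₂]
  have hresCount : s₄.reg resCount = s₁.reg emitted := by
    rw [hr' _ (fun x => by change 14 ≠ 3 * x + 26; omega)]; simp [hs₃]
  have hem : s₄.reg emitted = 0 := by rw [hr' _ emitted_ne_reg]; simp [hs₃]
  have hwr : s₄.reg written = 0 := by rw [hr' _ written_ne_reg]; simp [hs₃]
  have harr' : s₄.arr = s₁.arr := harr
  have hread : ∀ a i, read s₄ ver a i = 0 := by
    intro a i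
    rw [read, if_neg]
    rw [harr', hver]
    have := h₁.tag_le a i
    omega
  have ei : Exec (incr ver) (s₁.setReg resVer (s₁.reg ver)) 2 (s₂.setReg ver (s₁.reg ver + 1)) := by
    simpa using exec_incr (s₁.setReg resVer (s₁.reg ver)) ver (by decide)
  have ec := Exec.copy (s₂.setReg ver (s₁.reg ver + 1)) resCount emitted
  rw [show (s₂.setReg ver (s₁.reg ver + 1)).reg emitted = s₁.reg emitted by simp [hs₂]] at ec
  refine ⟨_, s₄, .seq e₁ (.seq (.copy _ _ _) (.seq ei (.seq ec (.seq (.const _ _ _)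
    (.seq (.const _ _ _) e₄))))), by omega, ?_, ?_⟩
  · refine ⟨fun x => ?_, fun a => ?_, ⟨fun x hx => ?_, fun a i => ?_, fun i => ?_, fun a i => ?_,
      ?_, ?_⟩, fun i => ?_, fun i => ?_, ?_, ?_, ?_, ?_⟩
    · have : var (cv x) % 3 ≠ 2 := by rw [Nat.mul_mod_right]; decide
      rw [hreg _ this, f₁.reg _ this]; exact h.reg x
    · rw [harr', f₁.arr]; exact h.arr a
    · rw [hr x hx]; simp [State.init, Config.call]
    · rw [hread]; simp [State.init, Config.call]
    · rw [hread]; simp [State.init]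
    · rw [harr', hver]; have := h₁.tag_le a i; omega
    · rw [hwr]; simp [State.init]
    · rw [hem]; simp [State.init]
    · rw [read, hresVer, harr']; exact h₁.buf i
    · rw [hresVer, harr']; exact h₁.tag_le 0 i
    · rw [hresVer, hver]; omega
    · rw [hresCount]; exact h₁.emitted
    · exact hcur.trans (f₁.current.trans h.current)
    · exact hout.trans (f₁.out.trans h.out)
  · intro x hx
    rw [hreg x hx, f₁.reg x hx]

end Guest

open Guest

/-- Nested loops do not interfere: a command compiled at depth `d` preserves the counters of all
smaller depths, and a loop compiles its body at depth `d + 1`. The factor `bound p + 10` pays for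
the most expensive bookkeeping, that of a call. -/
theorem Cmd.exec_compile [DecidableEq V] [DecidableEq A] {p : Program} {f : Word → State} {τ : Word → ℕ}
    (hf : ∀ w, Exec p (State.init w) (τ w) (f w)) (cv : V ↪ ℕ) (ca : A ↪ ℕ) (c : Cmd V A) :
    ∀ (d : ℕ) {s : State} {u : Config V A}, HostRep p cv ca s u →
      ∃ t s', Exec (c.compile p cv ca d) s t s' ∧ t ≤ (bound p + 10) * c.cost f τ u ∧
        HostRep p cv ca s' (c.eval f u) ∧ ∀ e < d, s'.reg (counter e) = s.reg (counter e) := by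
  have hvar : ∀ (x : V) (e : ℕ) (s : State) (k : ℤ),
      (s.setReg (var (cv x)) k).reg (counter e) = s.reg (counter e) := by
    intro x e s k
    rw [State.setReg_reg, if_neg (by change ¬ 3 * e + 1 = 3 * cv x; omega)]
  have hone : ∀ (e : ℕ) (s : State) (r : ℕ) (k : ℤ), r % 3 = 2 →
      (s.setReg r k).reg (counter e) = s.reg (counter e) := by
    intro e s r k hr
    rw [State.setReg_reg, if_neg]
    rintro rfl
    have : ∀ z, (3 * z + 1) % 3 ≠ 2 := by omega
    exact this e hr
  induction c with
  | skip =>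
    intro d s u h
    exact ⟨_, _, .skip _, by simp [cost], h, fun _ _ => rfl⟩
  | const x k =>
    intro d s u h
    exact ⟨_, _, .const _ _ _, by simp [cost], h.set x k, fun e _ => hvar ..⟩
  | add x y z =>
    intro d s u h
    refine ⟨_, _, .add _ _ _ _, by simp [cost], ?_, fun e _ => hvar ..⟩
    rw [h.reg, h.reg]; exact h.set ..
  | sub x y z =>
    intro d s u h
    refine ⟨_, _, .sub _ _ _ _, by simp [cost], ?_, fun e _ => hvar ..⟩
    rw [h.reg, h.reg]; exact h.set ..
  | half x y =>
    intro d s u h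
    refine ⟨_, _, .half _ _ _, by simp [cost], ?_, fun e _ => hvar ..⟩
    rw [h.reg]; exact h.set ..
  | size x y =>
    intro d s u h
    obtain ⟨k, k₃, e⟩ := Guest.exec_size s (var (cv x)) (var (cv y))
    rw [h.reg] at e
    refine ⟨_, _, e, ?_, ?_, fun e _ => ?_⟩
    · simp only [cost]; nlinarith
    · exact (((h.setReg_free (by simp) k).setReg_free (by simp) _).setReg_free (by simp) k₃).set ..
    · rw [hvar, hone _ _ _ _ rfl, hone _ _ _ _ rfl, hone _ _ _ _ rfl]
  | load x a y =>
    intro d s u h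
    refine ⟨_, _, .load _ _ _ _, by simp [cost], ?_, fun e _ => hvar ..⟩
    rw [h.reg, h.arr]; exact h.set ..
  | store a y x =>
    intro d s u h
    refine ⟨_, _, .store _ _ _ _, by simp [cost], ?_, fun e _ => rfl⟩
    rw [h.reg, h.reg]; exact h.store ..
  | write x =>
    intro d s u h
    refine ⟨_, _, .write _ _, by simp [cost], ?_, fun e _ => rfl⟩
    rw [h.reg]
    exact ⟨h.reg, h.arr, ⟨h.guest.reg, h.guest.arr, h.guest.buf, h.guest.tag_le, h.guest.written,
      h.guest.emitted⟩, h.res, h.tag_le, h.ver_lt, h.count, by simp [eval, h.current], h.out⟩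
  | emit =>
    intro d s u h
    refine ⟨_, _, .emit _, by simp [cost], ?_, fun e _ => rfl⟩
    exact ⟨h.reg, h.arr, ⟨h.guest.reg, h.guest.arr, h.guest.buf, h.guest.tag_le, h.guest.written,
      h.guest.emitted⟩, h.res, h.tag_le, h.ver_lt, h.count, rfl, by simp [eval, h.current, h.out]⟩
  | push x =>
    intro d s u h
    have hne : ∀ y, y % 3 ≠ 2 ∨ y ≤ 23 → y ≠ Guest.reg 0 := by
      rintro y hy rfl; revert hy; decide
    refine ⟨_, _, .seq (exec_store _ _ _ _) (exec_incr _ _ (by decide)), by simp [cost],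
      ?_, fun e _ => ?_⟩
    · have hg := h.guest.push (Nat.succ_pos _) (s.reg (var (cv x)))
      rw [h.reg] at hg ⊢
      set s' := ((Guest.setCell s 1 (s.reg (Guest.reg 0)) (u.reg x)).setReg tmp 1).setReg
        (Guest.reg 0) (s.reg (Guest.reg 0) + 1) with hs'
      have hr : ∀ y, y % 3 ≠ 2 ∨ y ≤ 16 → s'.reg y = s.reg y := by
        intro y hy
        rw [hs', State.setReg_reg, if_neg (hne y (by omega)), State.setReg_reg, if_neg]
        · rfl
        · rintro rfl; revert hy; decide
      have htag : s'.arr (tag 0) = s.arr (tag 0) := by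
        funext i
        rw [hs', State.setReg_arr, State.setReg_arr, setCell_tag, if_neg (by omega)]
      have hdata : s'.arr (data 0) = s.arr (data 0) := by
        rw [hs', State.setReg_arr, State.setReg_arr, Guest.setCell,
          State.setArr_arr_of_ne _ _ _ (by decide), State.setArr_arr_of_ne _ _ _ (by decide)]
      change HostRep p cv ca s' { u with query := u.query ++ [u.reg x] }
      refine ⟨fun y => ?_, fun a => ?_, hg, fun i => ?_, fun i => ?_, ?_, ?_, h.current, h.out⟩
      · rw [hr _ (by left; rw [Nat.mul_mod_right]; decide)]; exact h.reg y
      · rw [hs', State.setReg_arr, State.setReg_arr, (Frame.setCell ..).arr]; exact h.arr a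
      · rw [Guest.read, hr _ (by decide), htag, hdata]; exact h.res i
      · rw [hr _ (by decide), htag]; exact h.tag_le i
      · rw [hr _ (by decide), hr _ (by decide)]; exact h.ver_lt
      · rw [hr _ (by decide)]; exact h.count
    · rw [hone _ _ _ _ (by decide), hone _ _ _ _ rfl]; rfl
  | call =>
    intro d s u h
    obtain ⟨t, s', e, ht, h', hr⟩ := exec_call hf h
    refine ⟨t, s', e, ?_, h', fun e _ => hr _ ?_⟩
    · simp only [cost]; nlinarith
    · change (3 * e + 1) % 3 ≠ 2; omega
  | result x y =>
    intro d s u h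
    obtain ⟨t, k, ht, e⟩ := exec_load s resVer (var (cv x)) 0 (var (cv y)) (by decide)
      (var_ne (by decide)).symm (h.tag_le _)
    rw [h.reg, h.res] at e
    refine ⟨t, _, e, by simp only [cost]; omega, (h.setReg_free (by simp) k).set .., fun e _ => ?_⟩
    rw [hvar, hone _ _ _ _ rfl]
  | count x =>
    intro d s u h
    refine ⟨_, _, .copy _ _ _, by simp [cost], ?_, fun e _ => hvar ..⟩
    rw [h.count]; exact h.set ..
  | seq c c' ih ih' =>
    intro d s u h
    obtain ⟨t, s₁, e, ht, h₁, hr⟩ := ih d h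
    obtain ⟨t', s₂, e', ht', h₂, hr'⟩ := ih' d h₁
    refine ⟨_, _, .seq e e', ?_, h₂, fun e he => (hr' e he).trans (hr e he)⟩
    simp only [cost]
    rw [mul_add]; omega
  | ifPos x c c' ih ih' =>
    intro d s u h
    by_cases hx : 0 < u.reg x
    · obtain ⟨t, s₁, e, ht, h₁, hr⟩ := ih d h
      refine ⟨_, _, .ifPos_true (by rwa [h.reg]) e, ?_, by simpa [eval, hx] using h₁, hr⟩
      simp only [cost, hx, if_true]
      rw [mul_add]; omega
    · obtain ⟨t, s₁, e, ht, h₁, hr⟩ := ih' d h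
      refine ⟨_, _, .ifPos_false (by rwa [h.reg]) e, ?_, by simpa [eval, hx] using h₁, hr⟩
      simp only [cost, hx, if_false]
      rw [mul_add]; omega
  | ifEq x y c c' ih ih' =>
    intro d s u h
    have h₁ := h.setReg_free (x := tmp) (by simp) (s.reg (var (cv x)) - s.reg (var (cv y)))
    have h₂ := h₁.setReg_free (x := tmp) (by simp)
      ((s.setReg tmp (s.reg (var (cv x)) - s.reg (var (cv y)))).reg (var (cv y)) -
        (s.setReg tmp (s.reg (var (cv x)) - s.reg (var (cv y)))).reg (var (cv x)))
    -- Equality is decided by two positivity tests, of `x - y` and of `y - x`; the three orderings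
    -- take three different paths through the compiled code.
    rcases lt_trichotomy (u.reg y) (u.reg x) with hxy | hxy | hxy
    · obtain ⟨t, s', e, ht, h', hr⟩ := ih' d h₁
      refine ⟨_, _, .seq (.sub _ _ _ _) (.ifPos_true ?_ e), ?_, ?_, fun e he => ?_⟩
      · simp [h.reg, hxy]
      · simp only [cost, hxy.ne', if_false]
        rw [mul_add]; omega
      · simpa [eval, hxy.ne'] using h'
      · rw [hr e he, hone _ _ _ _ rfl]
    · obtain ⟨t, s', e, ht, h', hr⟩ := ih d h₂
      refine ⟨_, _, .seq (.sub _ _ _ _) (.ifPos_false ?_ (.seq (.sub _ _ _ _)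
        (.ifPos_false ?_ e))), ?_, ?_, fun e he => ?_⟩
      · simp [h.reg, hxy]
      · rw [State.setReg_reg, if_pos rfl, h₁.reg, h₁.reg, hxy]; omega
      · simp only [cost, hxy, if_true]
        rw [mul_add]; omega
      · simpa [eval, hxy] using h'
      · rw [hr e he, hone _ _ _ _ rfl, hone _ _ _ _ rfl]
    · obtain ⟨t, s', e, ht, h', hr⟩ := ih' d h₂
      refine ⟨_, _, .seq (.sub _ _ _ _) (.ifPos_false ?_ (.seq (.sub _ _ _ _)
        (.ifPos_true ?_ e))), ?_, ?_, fun e he => ?_⟩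
      · simp [h.reg, hxy.le]
      · rw [State.setReg_reg, if_pos rfl, h₁.reg, h₁.reg]; omega
      · simp only [cost, hxy.ne, if_false]
        rw [mul_add]; omega
      · simpa [eval, hxy.ne] using h'
      · rw [hr e he, hone _ _ _ _ rfl, hone _ _ _ _ rfl]
  | loop x c ih =>
    -- Induction on the number of iterations left, which is the content of the counter. The loop
    -- variable itself may be overwritten by the body, because its value was copied beforehand.
    have key : ∀ (n d : ℕ) (s : State) (u : Config V A), HostRep p cv ca s u →
        (s.reg (counter d)).toNat = n →
        ∃ t s', Exec (.whilePos (counter d) <| .seq (c.compile p cv ca (d + 1)) <|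
            .seq (.const tmp 1) (.sub (counter d) (counter d) tmp)) s t s' ∧
          t ≤ (bound p + 10) * (∑ i ∈ Finset.range n, (1 + c.cost f τ ((c.eval f)^[i] u))) + 1 ∧
          HostRep p cv ca s' ((c.eval f)^[n] u) ∧
          ∀ e < d, s'.reg (counter e) = s.reg (counter e) := by
      intro n
      induction n with
      | zero =>
        intro d s u h hn
        exact ⟨_, _, .whilePos_false (by omega), by simp, h, fun _ _ => rfl⟩
      | succ n ihn =>
        intro d s u h hn
        obtain ⟨t, s₁, e, ht, h₁, hr⟩ := ih (d + 1) h
        have hc := hr d (by omega)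
        have hne : counter d ≠ tmp := by change 3 * d + 1 ≠ 17; omega
        have h₂ := (h₁.setReg_free (x := tmp) (by simp) 1).setReg_free (x := counter d)
          (by left; change (3 * d + 1) % 3 = 1; omega) (s.reg (counter d) - 1)
        obtain ⟨t', s', e', ht', h', hr'⟩ := ihn d _ _ h₂ (by simp; omega)
        have e₁ := Exec.sub (s₁.setReg tmp 1) (counter d) (counter d) tmp
        rw [show (s₁.setReg tmp 1).reg (counter d) - (s₁.setReg tmp 1).reg tmp =
          s.reg (counter d) - 1 by
            rw [State.setReg_reg, if_neg hne, State.setReg_reg, if_pos rfl, hc]] at e₁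
        refine ⟨_, _, .whilePos_true (by omega) (.seq e (.seq (.const _ _ _) e₁)) e', ?_, h', ?_⟩
        · rw [Finset.sum_range_succ', mul_add, mul_add]
          simp only [Function.iterate_succ, Function.comp_apply, Function.iterate_zero, id_eq]
          omega
        · intro i hi
          rw [hr' i hi, State.setReg_reg, if_neg (by change ¬ 3 * i + 1 = 3 * d + 1; omega),
            hone _ _ _ _ rfl, hr i (by omega)]
    intro d s u h
    have h₁ := h.setReg_free (x := counter d)
      (by left; change (3 * d + 1) % 3 = 1; omega) (s.reg (var (cv x)))
    obtain ⟨t, s', e, ht, h', hr⟩ := key (u.reg x).toNat d _ u h₁ (by simp [h.reg])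
    refine ⟨_, _, .seq (.copy _ _ _) e, ?_, h', fun e he => ?_⟩
    · simp only [cost]
      rw [mul_add]; omega
    · rw [hr e he, State.setReg_reg, if_neg (by change ¬ 3 * e + 1 = 3 * d + 1; omega)]

/-- The configuration with input `w` in the array `a`. -/
def Config.init [DecidableEq A] (a : A) (w : Word) : Config V A where
  reg _ := 0
  arr b i := if b = a then w.cell i else 0
  query := []
  res := []
  count := 0
  current := []
  out := []

/-- Complete programs. -/
def Cmd.toProgram (p : Program) (cv : V ↪ ℕ) (ca : A ↪ ℕ) (c : Cmd V A) : Program :=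
  .seq (.const ver 1) (c.compile p cv ca 0)

/-- The machine starts with the input in array 0 and its length in register 0, so the input array
must have number 0, and no variable may use register 0. The version starts at 1 so that it lies
strictly above `resVer`, which is 0 like all tags. -/
theorem Cmd.runs_toProgram [DecidableEq V] [DecidableEq A] {p : Program} {f : Word → State} {τ : Word → ℕ}
    (hf : ∀ w, Exec p (State.init w) (τ w) (f w)) (cv : V ↪ ℕ) (ca : A ↪ ℕ)
    (hcv : ∀ x, cv x ≠ 0) {a : A} (ha : ca a = 0) (c : Cmd V A) (w : Word) :
    ∃ t, Runs (c.toProgram p cv ca) w t (c.eval f (.init a w)).out ∧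
      t ≤ (bound p + 10) * c.cost f τ (.init a w) + 1 := by
  have h : HostRep p cv ca ((State.init w).setReg ver 1) (Config.init a w) := by
    have hr : ∀ x, x ≠ 0 → x ≠ ver → ((State.init w).setReg ver 1).reg x = 0 := by
      intro x h₁ h₂
      simp [State.init, h₁, h₂]
    have hz : ∀ b, b ≠ 0 → ((State.init w).setReg ver 1).arr b = fun _ => 0 := by
      intro b hb
      simp [State.init, hb]
    have hread : ∀ V b i, Guest.read ((State.init w).setReg ver 1) V b i = 0 := by
      intro V b i
      rw [Guest.read, hz (data b) (by change 3 * b + 1 ≠ 0; omega)]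
      simp
    have htag : ∀ b, ((State.init w).setReg ver 1).arr (tag b) = fun _ => 0 := fun b =>
      hz _ (by change 3 * b + 2 ≠ 0; omega)
    refine ⟨fun x => ?_, fun b => ?_, ⟨fun x hx => ?_, fun a i => ?_, fun i => ?_, fun a i => ?_,
      ?_, ?_⟩, fun i => ?_, fun i => ?_, ?_, ?_, rfl, rfl⟩
    · rw [hr _ ?_ (var_ne (by decide)).symm]
      · rfl
      · have := hcv x
        change 3 * cv x ≠ 0
        omega
    · funext i
      by_cases hb : b = a
      · subst hb
        simp [Config.init, ha, State.init, Word.cell]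
      · have : 3 * ca b ≠ 0 := by
          intro h0
          exact hb (ca.injective (by omega))
        rw [hz _ this]
        simp [Config.init, hb]
    · rw [hr _ (by change 3 * x + 26 ≠ 0; omega) (ver_ne_reg x).symm]
      simp [State.init, Config.init]
    · rw [hread]; simp [State.init, Config.init]
    · rw [hread]; simp [State.init]
    · rw [htag]; simp
    · rw [hr _ (by decide) (by decide)]; simp [State.init]
    · rw [hr _ (by decide) (by decide)]; simp [State.init]
    · rw [hread]; simp [Config.init]
    · rw [htag, hr _ (by decide) (by decide)]
    · rw [hr _ (by decide) (by decide)]; simp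
    · rw [hr _ (by decide) (by decide)]; simp [Config.init]
  obtain ⟨t, s', e, ht, h', _⟩ := c.exec_compile hf cv ca 0 h
  exact ⟨1 + t, ⟨s', .seq (.const _ _ _) e, h'.out⟩, by omega⟩

end RAM

/-! ### Instances derived from a single-objective problem -/

namespace MCIF

theorem opposite_outcome (P : MCIF 1) (f : Fin P.m → ℤ) :
    P.opposite.outcome f = ![P.outcome f 0, - P.outcome f 0] := by
  funext k
  fin_cases k
  · rfl
  · change ∑ a, -P.cost 0 a * (f a : ℚ) = -∑ a, P.cost 0 a * (f a : ℚ)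
    simp

/-- If one flow is at most another in both `c` and `-c`, the costs agree, so nothing is dominated.
With weights `1/2` every flow has scalarized value 0 and is optimal. -/
theorem opposite_isSupportedEfficient (P : MCIF 1) {f : Fin P.m → ℤ} (hf : P.IsFeasible f) :
    P.opposite.IsSupportedEfficient f := by
  refine ⟨⟨hf, ?_⟩, fun _ => 1 / 2, fun _ => by norm_num, by norm_num, fun g _ => ?_⟩
  · rintro ⟨g, _, hle, hne⟩
    rw [P.opposite_outcome g, P.opposite_outcome f] at hle hne
    have h₀ := hle 0
    have h₁ := hle 1
    apply hne
    simp only [Matrix.cons_val_zero, Matrix.cons_val_one, neg_le_neg_iff] at h₀ h₁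
    rw [le_antisymm h₀ h₁]
  · rw [P.opposite_outcome g, P.opposite_outcome f]
    simp

theorem mem_opposite_supportedNondominated (P : MCIF 1) (y : Fin 2 → ℚ) :
    y ∈ P.opposite.supportedNondominated ↔
      ∃ f : Fin P.m → ℤ, P.IsFeasible f ∧ ![P.outcome f 0, - P.outcome f 0] = y := by
  constructor
  · rintro ⟨f, hf, rfl⟩
    exact ⟨f, hf.1.1, (P.opposite_outcome f).symm⟩
  · rintro ⟨f, hf, rfl⟩
    exact ⟨f, P.opposite_isSupportedEfficient hf, P.opposite_outcome f⟩

/-- The bi-objective problem in which both objectives are the flow on the arc `a`. -/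
def arcFlow (P : MCIF 1) (a : Fin P.m) : MCIF 2 where
  toFlowNetwork := P.toFlowNetwork
  cost := fun _ b => if b = a then 1 else 0

theorem arcFlow_outcome (P : MCIF 1) (a : Fin P.m) (f : Fin P.m → ℤ) :
    (P.arcFlow a).outcome f = fun _ => (f a : ℚ) := by
  funext k
  change ∑ b, (if b = a then (1 : ℚ) else 0) * (f b : ℚ) = f a
  simp

/-- The two objectives coincide, so outcomes are totally ordered and nondominated means minimal.
Together with the next lemma, this gives exactly one supported nondominated vector on a feasible
instance. -/
theorem mem_arcFlow_supportedNondominated (P : MCIF 1) (a : Fin P.m) {y : Fin 2 → ℚ}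
    (hy : y ∈ (P.arcFlow a).supportedNondominated) :
    ∃ f : Fin P.m → ℤ, P.IsFeasible f ∧ (y = fun _ => (f a : ℚ)) ∧
      ∀ g : Fin P.m → ℤ, P.IsFeasible g → f a ≤ g a := by
  obtain ⟨f, hf, rfl⟩ := hy
  refine ⟨f, hf.1.1, P.arcFlow_outcome a f, fun g hg => ?_⟩
  by_contra! hlt
  refine hf.1.2 ⟨g, hg, ?_, ?_⟩
  · rw [P.arcFlow_outcome a g, P.arcFlow_outcome a f]
    intro k
    change (g a : ℚ) ≤ f a
    exact_mod_cast hlt.le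
  · rw [P.arcFlow_outcome a g, P.arcFlow_outcome a f]
    intro h
    have := congrFun h 0
    simp only [Int.cast_inj] at this
    omega

theorem arcFlow_supportedNondominated_nonempty (P : MCIF 1) (a : Fin P.m)
    (h : ∃ f : Fin P.m → ℤ, P.IsFeasible f) :
    (P.arcFlow a).supportedNondominated.Nonempty := by
  -- Flows on an arc are bounded below by 0 since lower capacities are natural numbers, so the
  -- minimum is attained.
  obtain ⟨z, ⟨f, hf, rfl⟩, hz⟩ := Int.exists_least_of_bdd
    (P := fun z => ∃ f : Fin P.m → ℤ, P.IsFeasible f ∧ f a = z)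
    ⟨0, by rintro z ⟨f, hf, rfl⟩; exact (Int.natCast_nonneg _).trans (hf.2 a).1⟩
    (by obtain ⟨f, hf⟩ := h; exact ⟨f a, f, hf, rfl⟩)
  have hmin : ∀ g : Fin P.m → ℤ, P.IsFeasible g → f a ≤ g a := fun g hg => hz _ ⟨g, hg, rfl⟩
  refine ⟨_, f, ⟨⟨hf, ?_⟩, fun _ => 1 / 2, fun _ => by norm_num, by norm_num,
    fun g hg => ?_⟩, rfl⟩
  · rintro ⟨g, hg, hle, hne⟩
    rw [P.arcFlow_outcome a g, P.arcFlow_outcome a f] at hle hne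
    apply hne
    have h₀ := hle 0
    simp only [Int.cast_le] at h₀
    rw [le_antisymm h₀ (hmin g hg)]
  · rw [P.arcFlow_outcome a g, P.arcFlow_outcome a f]
    have : ((f a : ℤ) : ℝ) ≤ g a := by exact_mod_cast hmin g hg
    simp only [Fin.sum_univ_two, Rat.cast_intCast]
    linarith

/-- The problem with other capacities. -/
def restrict (P : MCIF 1) (lo up : Fin P.m → ℕ) : MCIF 1 where
  n := P.n
  m := P.m
  tail := P.tail
  head := P.head
  arc_injective := P.arc_injective
  balance := P.balance
  lower := lo
  upper := up
  cost := P.cost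

theorem isFeasible_of_restrict {P : MCIF 1} {lo up : Fin P.m → ℕ} {f : Fin P.m → ℤ}
    (h : (P.restrict lo up).IsFeasible f) (hlo : P.lower ≤ lo) (hup : up ≤ P.upper) :
    P.IsFeasible f :=
  ⟨h.1, fun a => ⟨le_trans (by exact_mod_cast hlo a) (h.2 a).1,
    (h.2 a).2.trans (by exact_mod_cast hup a)⟩⟩

/-! ### Encodings -/

theorem encodeVector_two (y : Fin 2 → ℚ) :
    encodeVector y = [(y 0).num, ((y 0).den : ℤ), (y 1).num, ((y 1).den : ℤ)] := by
  simp [encodeVector, encodeRat, List.ofFn_succ]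

theorem encodeVector_one (y : Fin 1 → ℚ) : encodeVector y = [(y 0).num, ((y 0).den : ℤ)] := by
  simp [encodeVector, encodeRat, List.ofFn_succ]

/-- The common form of the encodings of the problems on the network of `P`, where `κ a` encodes
the costs of the arc `a`. -/
def encodeWith (P : MCIF 1) (lo up : Fin P.m → ℕ) (κ : Fin P.m → RAM.Word) : RAM.Word :=
  [(P.n : ℤ), (P.m : ℤ)] ++ List.ofFn P.balance ++
    (List.finRange P.m).flatMap fun a =>
      [((P.tail a : ℕ) : ℤ), ((P.head a : ℕ) : ℤ), (lo a : ℤ), (up a : ℤ)] ++ κ a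

theorem encode_eq (P : MCIF 1) :
    P.encode = P.encodeWith P.lower P.upper
      fun a => [(P.cost 0 a).num, ((P.cost 0 a).den : ℤ)] := by
  simp [encode, encodeWith, encodeVector_one]

/-- Encoding of the costs of `MCIF.opposite`. -/
def oppositeCosts (P : MCIF 1) (a : Fin P.m) : RAM.Word :=
  [(P.cost 0 a).num, ((P.cost 0 a).den : ℤ), -(P.cost 0 a).num, ((P.cost 0 a).den : ℤ)]

/-- Encoding of the costs of `MCIF.arcFlow`. -/
def arcFlowCosts (P : MCIF 1) (b a : Fin P.m) : RAM.Word :=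
  [if a = b then 1 else 0, 1, if a = b then 1 else 0, 1]

/-- Negating a rational negates its numerator and keeps its denominator by definition, so the
machine can produce this encoding without arithmetic on fractions. -/
theorem encode_opposite (P : MCIF 1) (lo up : Fin P.m → ℕ) :
    (P.restrict lo up).opposite.encode = P.encodeWith lo up P.oppositeCosts := by
  simp only [encode, encodeWith, encodeVector_two]
  rfl

theorem encode_arcFlow (P : MCIF 1) (lo up : Fin P.m → ℕ) (b : Fin P.m) :
    ((P.restrict lo up).arcFlow b).encode = P.encodeWith lo up (P.arcFlowCosts b) := by
  have h : ∀ a : Fin P.m, ((if a = b then (1 : ℚ) else 0).num = if a = b then 1 else 0) ∧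
      (if a = b then (1 : ℚ) else 0).den = 1 := by
    intro a; split_ifs <;> simp
  have h' : ∀ a : Fin P.m, encodeVector (fun _ : Fin 2 => if a = b then (1 : ℚ) else 0) =
      P.arcFlowCosts b a := by
    intro a
    rw [encodeVector_two, (h a).1, (h a).2]
    rfl
  simp only [encodeWith, ← h']
  rfl

theorem size_append (v w : RAM.Word) : RAM.Word.size (v ++ w) = v.size + w.size := by
  simp [RAM.Word.size]

theorem length_le_size (w : RAM.Word) : w.length ≤ w.size := by
  induction w with
  | nil => simp
  | cons z w ih =>
    simp only [RAM.Word.size, List.map_cons, List.sum_cons, List.length_cons] at ih ⊢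
    omega

theorem size_flatMap_le {α : Type} (l : List α) (g h : α → RAM.Word) (k : ℕ)
    (H : ∀ a ∈ l, (g a).size ≤ k * (h a).size) :
    RAM.Word.size (l.flatMap g) ≤ k * RAM.Word.size (l.flatMap h) := by
  induction l with
  | nil => simp [RAM.Word.size]
  | cons a l ih =>
    rw [List.flatMap_cons, List.flatMap_cons, size_append, size_append, mul_add]
    exact add_le_add (H a (by simp)) (ih fun b hb => H b (by simp [hb]))

/-- A raised lower capacity may be longer than the original one, but both new capacities are bounded
by `P.upper` and are charged to it. The costs at most double, up to an additive constant per arc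
absorbed by the sign symbols; the factor 4 covers all of this. -/
theorem encodeWith_size_le (P : MCIF 1) {lo up : Fin P.m → ℕ} {κ : Fin P.m → RAM.Word}
    (h₁ : lo ≤ up) (h₂ : up ≤ P.upper)
    (hκ : ∀ a, (κ a).size ≤ 2 * RAM.Word.size [(P.cost 0 a).num, ((P.cost 0 a).den : ℤ)] + 4) :
    (P.encodeWith lo up κ).size ≤ 4 * P.encode.size := by
  rw [encode_eq, encodeWith, encodeWith, size_append, size_append, size_append, size_append, mul_add]
  refine add_le_add (by omega) (size_flatMap_le _ _ _ _ fun a _ => ?_)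
  rw [size_append, size_append]
  have hup := Nat.size_le_size (h₂ a)
  have hlo := Nat.size_le_size ((h₁ a).trans (h₂ a))
  have := hκ a
  simp only [RAM.Word.size, List.map_cons, List.map_nil, List.sum_cons, List.sum_nil,
    Int.natAbs_natCast] at *
  omega

theorem oppositeCosts_size_le (P : MCIF 1) (a : Fin P.m) : (P.oppositeCosts a).size ≤
    2 * RAM.Word.size [(P.cost 0 a).num, ((P.cost 0 a).den : ℤ)] + 4 := by
  simp only [oppositeCosts, RAM.Word.size, List.map_cons, List.map_nil, List.sum_cons,
    List.sum_nil, Int.natAbs_neg]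
  omega

theorem arcFlowCosts_size_le (P : MCIF 1) (b a : Fin P.m) : (P.arcFlowCosts b a).size ≤
    2 * RAM.Word.size [(P.cost 0 a).num, ((P.cost 0 a).den : ℤ)] + 4 := by
  simp only [arcFlowCosts, RAM.Word.size, List.map_cons, List.map_nil, List.sum_cons,
    List.sum_nil]
  split_ifs <;> simp <;> omega

/-- Random access into a concatenation of blocks of equal length `k`. It is used with `k = 6` for
the arcs in the input and `k = 4` for the vectors in an answer. -/
theorem getD_flatMap {α : Type} (g : α → RAM.Word) (k : ℕ) :
    ∀ (l : List α), (∀ a ∈ l, (g a).length = k) → ∀ (i : ℕ) (hi : i < l.length) (j : ℕ), j < k →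
      (l.flatMap g).getD (k * i + j) 0 = (g l[i]).getD j 0 := by
  intro l
  induction l with
  | nil => intro _ i hi; simp at hi
  | cons a l ih =>
    intro h i hi j hj
    rw [List.flatMap_cons]
    have ha := h a (by simp)
    cases i with
    | zero => rw [List.getD_append _ _ _ _ (by omega)]; simp
    | succ i =>
      rw [List.getD_append_right _ _ _ _ (by rw [ha]; nlinarith), ha,
        show k * (i + 1) + j - k = k * i + j by rw [mul_add]; omega,
        ih (fun b hb => h b (by simp [hb])) i (by simpa using hi) j hj]
      rfl

theorem encode_cell_n (P : MCIF 1) : P.encode.cell 0 = P.n := by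
  simp [encode_eq, encodeWith, RAM.Word.cell]

theorem encode_cell_m (P : MCIF 1) : P.encode.cell 1 = P.m := by
  simp [encode_eq, encodeWith, RAM.Word.cell]

theorem encode_cell_balance (P : MCIF 1) (i : Fin P.n) :
    P.encode.cell (2 + (i : ℕ)) = P.balance i := by
  rw [show (2 + ((i : ℕ) : ℤ)) = ((2 + (i : ℕ) : ℕ) : ℤ) by push_cast; rfl,
    RAM.Word.cell_natCast, encode_eq, encodeWith, List.append_assoc,
    List.getD_append_right _ _ _ _ (by simp), List.getD_append _ _ _ _ (by simp)]
  simp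

theorem encode_cell_arc (P : MCIF 1) (a : Fin P.m) (j : ℕ) (hj : j < 6) :
    P.encode.cell (2 + P.n + 6 * (a : ℕ) + j) =
      [((P.tail a : ℕ) : ℤ), ((P.head a : ℕ) : ℤ), (P.lower a : ℤ), (P.upper a : ℤ),
        (P.cost 0 a).num, ((P.cost 0 a).den : ℤ)].getD j 0 := by
  rw [show (2 + P.n + 6 * ((a : ℕ) : ℤ) + j) = ((2 + P.n + (6 * (a : ℕ) + j) : ℕ) : ℤ) by
      push_cast; ring,
    RAM.Word.cell_natCast, encode_eq, encodeWith,
    List.getD_append_right _ _ _ _ (by simp; omega)]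
  rw [show 2 + P.n + (6 * (a : ℕ) + j) -
    ([(P.n : ℤ), (P.m : ℤ)] ++ List.ofFn P.balance).length = 6 * (a : ℕ) + j by simp; omega]
  rw [getD_flatMap _ 6 _ (by simp) _ (by simp) _ hj]
  simp

theorem encode_length (P : MCIF 1) : P.encode.length = 2 + P.n + 6 * P.m := by
  simp [encode_eq, encodeWith, List.length_flatMap]
  omega

end MCIF

namespace RAM

/-! ### Effects of commands -/

namespace Cmd

variable {V A : Type}

/-- The variables that a command may change. -/
def regs : Cmd V A → List V
  | const x _ => [x]
  | add x _ _ => [x]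
  | sub x _ _ => [x]
  | half x _ => [x]
  | size x _ => [x]
  | load x _ _ => [x]
  | result x _ => [x]
  | count x => [x]
  | seq c d => c.regs ++ d.regs
  | ifPos _ c d => c.regs ++ d.regs
  | ifEq _ _ c d => c.regs ++ d.regs
  | loop _ c => c.regs
  | _ => []

/-- The arrays that a command may change. -/
def arrs : Cmd V A → List A
  | store a _ _ => [a]
  | seq c d => c.arrs ++ d.arrs
  | ifPos _ c d => c.arrs ++ d.arrs
  | ifEq _ _ c d => c.arrs ++ d.arrs
  | loop _ c => c.arrs
  | _ => []

/-- The command does not output anything. -/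
def silent : Cmd V A → Bool
  | write _ => false
  | emit => false
  | seq c d => c.silent && d.silent
  | ifPos _ c d => c.silent && d.silent
  | ifEq _ _ c d => c.silent && d.silent
  | loop _ c => c.silent
  | _ => true

/-- The command does not call the subroutine, or prepare its input. -/
def callFree : Cmd V A → Bool
  | push _ => false
  | call => false
  | seq c d => c.callFree && d.callFree
  | ifPos _ c d => c.callFree && d.callFree
  | ifEq _ _ c d => c.callFree && d.callFree
  | loop _ c => c.callFree
  | _ => true

/-- The difference between `u` and `v` can be caused by the command `c`. -/
structure Frame (c : Cmd V A) (u v : Config V A) : Prop where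
  reg : ∀ x, x ∉ c.regs → v.reg x = u.reg x
  arr : ∀ a, a ∉ c.arrs → v.arr a = u.arr a
  out : c.silent = true → v.current = u.current ∧ v.out = u.out
  query : c.callFree = true → v.query = u.query ∧ v.res = u.res ∧ v.count = u.count

theorem Frame.refl (c : Cmd V A) (u : Config V A) : Frame c u u :=
  ⟨fun _ _ => rfl, fun _ _ => rfl, fun _ => ⟨rfl, rfl⟩, fun _ => ⟨rfl, rfl, rfl⟩⟩

theorem Frame.trans {c : Cmd V A} {u v w : Config V A} (h : Frame c u v) (h' : Frame c v w) :
    Frame c u w where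
  reg x hx := (h'.reg x hx).trans (h.reg x hx)
  arr a ha := (h'.arr a ha).trans (h.arr a ha)
  out hc := ⟨(h'.out hc).1.trans (h.out hc).1, (h'.out hc).2.trans (h.out hc).2⟩
  query hc := ⟨(h'.query hc).1.trans (h.query hc).1, (h'.query hc).2.1.trans (h.query hc).2.1,
    (h'.query hc).2.2.trans (h.query hc).2.2⟩

theorem Frame.mono {c d : Cmd V A} {u v : Config V A} (h : Frame c u v)
    (h₁ : ∀ x, x ∉ d.regs → x ∉ c.regs) (h₂ : ∀ a, a ∉ d.arrs → a ∉ c.arrs)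
    (h₃ : d.silent = true → c.silent = true) (h₄ : d.callFree = true → c.callFree = true) :
    Frame d u v :=
  ⟨fun x hx => h.reg x (h₁ x hx), fun a ha => h.arr a (h₂ a ha), fun hd => h.out (h₃ hd),
    fun hd => h.query (h₄ hd)⟩

theorem frame_set [DecidableEq V] (u : Config V A) (x : V) (k : ℤ) (c : Cmd V A) (h : x ∈ c.regs) :
    Frame c u (u.set x k) :=
  ⟨fun y hy => Function.update_of_ne (by rintro rfl; exact hy h) _ _, fun _ _ => rfl,
    fun _ => ⟨rfl, rfl⟩, fun _ => ⟨rfl, rfl, rfl⟩⟩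

variable [DecidableEq V] [DecidableEq A]

theorem frame_iterate (f : Word → State) {c : Cmd V A} (h : ∀ u, Frame c u (c.eval f u)) (n : ℕ)
    (u : Config V A) : Frame c u ((c.eval f)^[n] u) := by
  induction n with
  | zero => exact .refl _ _
  | succ n ih => rw [Function.iterate_succ_apply']; exact ih.trans (h _)

/-- What a command leaves unchanged is read off its syntax. In the proofs about concrete commands,
preservation of variables and arrays thereby reduces to list membership, settled by `decide`. -/
theorem frame_eval (f : Word → State) (c : Cmd V A) : ∀ u, Frame c u (c.eval f u) := by
  induction c with
  | skip => exact fun u => .refl _ u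
  | store a y x =>
    intro u
    refine ⟨fun _ _ => rfl, fun b hb => ?_, fun _ => ⟨rfl, rfl⟩, fun _ => ⟨rfl, rfl, rfl⟩⟩
    exact Function.update_of_ne (by simpa [arrs] using hb) _ _
  | write x => exact fun u => ⟨fun _ _ => rfl, fun _ _ => rfl, nofun, fun _ => ⟨rfl, rfl, rfl⟩⟩
  | emit => exact fun u => ⟨fun _ _ => rfl, fun _ _ => rfl, nofun, fun _ => ⟨rfl, rfl, rfl⟩⟩
  | push x => exact fun u => ⟨fun _ _ => rfl, fun _ _ => rfl, fun _ => ⟨rfl, rfl⟩, nofun⟩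
  | call => exact fun u => ⟨fun _ _ => rfl, fun _ _ => rfl, fun _ => ⟨rfl, rfl⟩, nofun⟩
  | seq c d ihc ihd =>
    intro u
    refine ((ihc u).mono ?_ ?_ ?_ ?_).trans ((ihd _).mono ?_ ?_ ?_ ?_) <;>
      simp +contextual [regs, arrs, silent, callFree]
  | ifPos x c d ihc ihd =>
    intro u
    rw [eval]
    split
    · refine (ihc u).mono ?_ ?_ ?_ ?_ <;> simp +contextual [regs, arrs, silent, callFree]
    · refine (ihd u).mono ?_ ?_ ?_ ?_ <;> simp +contextual [regs, arrs, silent, callFree]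
  | ifEq x y c d ihc ihd =>
    intro u
    rw [eval]
    split
    · refine (ihc u).mono ?_ ?_ ?_ ?_ <;> simp +contextual [regs, arrs, silent, callFree]
    · refine (ihd u).mono ?_ ?_ ?_ ?_ <;> simp +contextual [regs, arrs, silent, callFree]
  | loop x c ih =>
    intro u
    exact (frame_iterate f ih _ u).mono (fun _ h => h) (fun _ h => h) (fun h => h) (fun h => h)
  | _ => exact fun u => frame_set _ _ _ _ (by simp [regs])

/-- Invariants of loops. -/
theorem loop_spec (f : Word → State) (τ : Word → ℕ) {c : Cmd V A} {x : V} {u : Config V A} {n : ℕ}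
    (hn : u.reg x = n) (I : ℕ → Config V A → Prop) (T : ℕ) (h₀ : I 0 u)
    (hs : ∀ i < n, ∀ v, Frame c u v → I i v → I (i + 1) (c.eval f v) ∧ c.cost f τ v ≤ T) :
    I n ((loop x c).eval f u) ∧ (loop x c).cost f τ u ≤ 1 + n * (1 + T) := by
  have hn' : (u.reg x).toNat = n := by omega
  have hI : ∀ i ≤ n, I i ((c.eval f)^[i] u) := by
    intro i
    induction i with
    | zero => exact fun _ => h₀
    | succ i ih =>
      intro hi
      rw [Function.iterate_succ_apply']
      exact (hs i (by omega) _ (frame_iterate f (frame_eval f c) i u) (ih (by omega))).1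
  refine ⟨by rw [eval, hn']; exact hI n le_rfl, ?_⟩
  rw [cost, hn']
  refine Nat.add_le_add_left ?_ 1
  rw [← smul_eq_mul]
  refine (Finset.sum_le_card_nsmul _ _ (1 + T) fun i hi => ?_).trans (by simp)
  have hi' := Finset.mem_range.mp hi
  exact Nat.add_le_add_left
    (hs i hi' _ (frame_iterate f (frame_eval f c) i u) (hI i hi'.le)).2 1

end Cmd

end RAM

/-! ### The reduction -/

namespace MCIF

namespace Reduction

open RAM (Cmd Config Word State)

/-- Variables of the reduction. -/
inductive Var
  | zero | one | two | three | n | m | ptr | idx | t₁ | t₂ | t₃ | arc | lo | hi | mid | found | j | k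
  | val | total | num | den | rounds
  deriving DecidableEq

/-- Arrays of the reduction. -/
inductive Arr
  | input | lo | up | num | den
  deriving DecidableEq

open RAM.Cmd

/-- Commands of the reduction. -/
abbrev Code := Cmd Var Arr

/-- Composition of a list of commands. -/
def block : List Code → Code
  | [] => skip
  | [c] => c
  | c :: l => seq c (block l)

/-- Read the next entry of the input. -/
def readNext (x : Var) : Code := seq (load x .input .ptr) (add .ptr .ptr .one)

/-- Copy the next entry of the input to the query. -/
def relay : Code := seq (readNext .t₁) (push .t₁)

/-- Write the cost coefficients of an arc with cost `t₁ / t₂`: the flow on the arc `arc`, or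
the costs of the opposite problem. -/
def pushCosts : Bool → Code
  | true => block [const .t₃ 0, ifEq .idx .arc (const .t₃ 1) skip,
      push .t₃, push .one, push .t₃, push .one]
  | false => block [push .t₁, push .t₂, sub .t₃ .zero .t₁, push .t₃, push .t₂]

/-- Write the data of an arc. -/
def pushArc (b : Bool) : Code :=
  block [relay, relay, add .ptr .ptr .two, load .t₁ .lo .idx, push .t₁, load .t₁ .up .idx, push .t₁,
    readNext .t₁, readNext .t₂, pushCosts b, add .idx .idx .one]

/-- Ask for the minimum flow on the arc `arc`, or for the values of all flows. -/
def query (b : Bool) : Code :=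
  block [const .ptr 0, relay, relay, loop .n relay, const .idx 0, loop .m (pushArc b), call]

/-- Initialize the capacities. -/
def resetArc : Code :=
  block [add .ptr .ptr .two, readNext .t₁, store .lo .idx .t₁, readNext .t₁, store .up .idx .t₁,
    add .ptr .ptr .two, add .idx .idx .one]

/-- Initialize the capacities. -/
def reset : Code := block [add .ptr .two .n, const .idx 0, loop .m resetArc]

/-- Compare a word of the result with the value `num / den`. -/
def searchStep : Code :=
  block [result .t₁ .j, add .j .j .one, result .t₂ .j, add .j .j .three,
    ifEq .t₁ .num (ifEq .t₂ .den (const .found 1) skip) skip]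

/-- Search for the value `num / den` in the result. -/
def search : Code := block [const .found 0, const .j 0, count .k, loop .k searchStep]

/-- Save the next value in the result. -/
def saveStep : Code :=
  block [result .t₁ .j, store .num .val .t₁, add .j .j .one, result .t₁ .j, store .den .val .t₁,
    add .j .j .three, add .val .val .one]

/-- Save all values in the result. -/
def save : Code := block [count .total, const .j 0, const .val 0, loop .total saveStep]

/-- Continue with the upper half of the interval. -/
def raise : Code := seq (add .mid .mid .one) (store .lo .arc .mid)

/-- Halve the interval of the arc `arc`. -/
def bisect : Code :=
  block [load .lo .lo .arc, load .hi .up .arc, add .mid .lo .hi, half .mid .mid,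
    query true, result .t₁ .zero, sub .t₁ .t₁ .mid,
    ifPos .t₁ raise (block [store .up .arc .mid, query false, search,
      ifPos .found skip (seq (store .up .arc .hi) raise)])]

/-- Fix the flow on the arc `arc`. -/
def fixArc : Code :=
  block [load .lo .lo .arc, load .hi .up .arc, sub .hi .hi .lo, size .rounds .hi,
    loop .rounds bisect, add .arc .arc .one]

/-- Write the flow on the next arc. -/
def writeArc : Code := block [load .t₁ .lo .idx, write .t₁, add .idx .idx .one]

/-- Find a flow with cost `num / den`, and output it. -/
def findFlow : Code :=
  block [reset, const .arc 0, loop .m fixArc, const .idx 0, loop .m writeArc, emit]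

/-- Find a flow for the next saved value. -/
def solveStep : Code :=
  block [load .num .num .val, load .den .den .val, findFlow, add .val .val .one]

/-- Initialize the constants. -/
def start : Code :=
  block [const .one 1, const .two 2, const .three 3, readNext .n, readNext .m]

/-- The reduction. -/
def main : Code :=
  block [start, reset, query false, save, const .val 0, loop .total solveStep]

/-! ### Building queries and reading their answers. -/

variable (f : Word → State) (τ : Word → ℕ)

/-- The variables and arrays that are constant after `start`. -/
structure Base (P : MCIF 1) (u : Config Var Arr) : Prop where
  zero : u.reg .zero = 0
  one : u.reg .one = 1
  two : u.reg .two = 2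
  three : u.reg .three = 3
  n : u.reg .n = P.n
  m : u.reg .m = P.m
  input : u.arr .input = P.encode.cell

theorem Base.of_frame {P : MCIF 1} {u v : Config Var Arr} (h : Base P u) {c : Code}
    (hF : c.Frame u v) (hc : ∀ x ∈ [Var.zero, .one, .two, .three, .n, .m], x ∉ c.regs)
    (ha : Arr.input ∉ c.arrs) : Base P v where
  zero := (hF.reg _ (hc _ (by decide))).trans h.zero
  one := (hF.reg _ (hc _ (by decide))).trans h.one
  two := (hF.reg _ (hc _ (by decide))).trans h.two
  three := (hF.reg _ (hc _ (by decide))).trans h.three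
  n := (hF.reg _ (hc _ (by decide))).trans h.n
  m := (hF.reg _ (hc _ (by decide))).trans h.m
  input := (hF.arr _ ha).trans h.input

@[simp] theorem set_reg (u : Config Var Arr) (x : Var) (k : ℤ) (y : Var) :
    (u.set x k).reg y = if y = x then k else u.reg y := Function.update_apply ..

@[simp] theorem set_arr (u : Config Var Arr) (x : Var) (k : ℤ) : (u.set x k).arr = u.arr := rfl
@[simp] theorem set_query (u : Config Var Arr) (x : Var) (k : ℤ) :
    (u.set x k).query = u.query := rfl
@[simp] theorem set_res (u : Config Var Arr) (x : Var) (k : ℤ) : (u.set x k).res = u.res := rfl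
@[simp] theorem set_count (u : Config Var Arr) (x : Var) (k : ℤ) :
    (u.set x k).count = u.count := rfl

/-- The capacities in the arrays `lo` and `up`. -/
structure Caps (P : MCIF 1) (lo up : Fin P.m → ℕ) (u : Config Var Arr) : Prop where
  lo : ∀ a : Fin P.m, u.arr .lo (a : ℕ) = lo a
  up : ∀ a : Fin P.m, u.arr .up (a : ℕ) = up a

theorem Caps.of_frame {P : MCIF 1} {lo up : Fin P.m → ℕ} {u v : Config Var Arr}
    (h : Caps P lo up u) {c : Code} (hF : c.Frame u v) (h₁ : Arr.lo ∉ c.arrs)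
    (h₂ : Arr.up ∉ c.arrs) : Caps P lo up v where
  lo a := by rw [hF.arr _ h₁]; exact h.lo a
  up a := by rw [hF.arr _ h₂]; exact h.up a

theorem relay_nodes_spec {P : MCIF 1} {u : Config Var Arr} (hB : Base P u)
    (hptr : u.reg .ptr = 2) :
    (((loop .n relay).eval f u).reg .ptr = 2 + P.n ∧
      ((loop .n relay).eval f u).query = u.query ++ List.ofFn P.balance) ∧
      (loop .n relay).cost f τ u ≤ 1 + P.n * (1 + 3) := by
  have := Cmd.loop_spec f τ (c := relay) hB.n (fun i v => v.reg .ptr = 2 + i ∧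
    v.query = u.query ++ (List.ofFn P.balance).take i) 3 (by simp [hptr]) (by
      intro i hi v hF hI
      have hB' := hB.of_frame hF (by decide) (by decide)
      refine ⟨⟨?_, ?_⟩, ?_⟩
      · simp [relay, readNext, eval, hI.1, hB'.one]; ring
      · have := P.encode_cell_balance ⟨i, hi⟩
        simp only at this
        simp [relay, readNext, eval, hI.1, hI.2, hB'.input, this]
        rw [List.take_add_one]
        simp [hi]
      · simp [relay, readNext, Cmd.cost])
  simpa [List.take_of_length_le] using this

/-- The words written by `pushCosts`. -/
def costWord (P : MCIF 1) (arc : ℤ) : Bool → Fin P.m → Word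
  | true, a => [if (a : ℕ) = arc then 1 else 0, 1, if (a : ℕ) = arc then 1 else 0, 1]
  | false, a => P.oppositeCosts a

theorem pushCosts_spec {P : MCIF 1} {u : Config Var Arr} (hB : Base P u) (b : Bool) (a : Fin P.m)
    (hidx : u.reg .idx = (a : ℕ)) (hx : u.reg .t₁ = (P.cost 0 a).num)
    (hy : u.reg .t₂ = ((P.cost 0 a).den : ℤ)) :
    ((pushCosts b).eval f u).query = u.query ++ costWord P (u.reg .arc) b a ∧
      (pushCosts b).cost f τ u ≤ 7 := by
  cases b
  · simp [pushCosts, block, eval, Cmd.cost, costWord, oppositeCosts, hx, hy, hB.zero]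
  · by_cases h : ((a : ℕ) : ℤ) = u.reg .arc
    · simp [pushCosts, block, eval, Cmd.cost, costWord, hidx, hB.one, h]
    · simp [pushCosts, block, eval, Cmd.cost, costWord, hidx, hB.one, h]

/-- Tails, heads and costs come from the input, capacities from the arrays `lo` and `up`. The
pointer skips the two capacities in the input, so it moves by six per arc. -/
theorem pushArc_loop_spec {P : MCIF 1} {lo up : Fin P.m → ℕ} {u : Config Var Arr}
    (hB : Base P u) (hC : Caps P lo up u) (b : Bool)
    (hptr : u.reg .ptr = 2 + P.n) (hidx : u.reg .idx = 0) :
    ((loop .m (pushArc b)).eval f u).query = u.query ++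
        ((List.finRange P.m).flatMap fun a =>
          [((P.tail a : ℕ) : ℤ), ((P.head a : ℕ) : ℤ), (lo a : ℤ), (up a : ℤ)] ++
            costWord P (u.reg .arc) b a) ∧
      (loop .m (pushArc b)).cost f τ u ≤ 1 + P.m * (1 + 25) := by
  have := Cmd.loop_spec f τ (c := pushArc b) hB.m (fun i v => v.reg .ptr = 2 + P.n + 6 * i ∧
    v.reg .idx = i ∧ v.query = u.query ++ ((List.finRange P.m).take i).flatMap fun a =>
          [((P.tail a : ℕ) : ℤ), ((P.head a : ℕ) : ℤ), (lo a : ℤ), (up a : ℤ)] ++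
            costWord P (u.reg .arc) b a) 25 (by simp [hptr, hidx]) (by
      intro i hi v hF hI
      have hB' := hB.of_frame hF (by cases b <;> decide) (by cases b <;> decide)
      have hC' := hC.of_frame hF (by cases b <;> decide) (by cases b <;> decide)
      have harc := hF.reg .arc (by cases b <;> decide)
      obtain ⟨h₁, h₂, h₃⟩ := hI
      set a : Fin P.m := ⟨i, hi⟩ with ha
      have c := P.encode_cell_arc a
      have c₀ := c 0 (by norm_num)
      have c₁ := c 1 (by norm_num)
      have c₄ := c 4 (by norm_num)
      have c₅ := c 5 (by norm_num)
      simp [ha] at c₀ c₁ c₄ c₅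
      -- The body is cut before `pushCosts`, the only part that depends on the kind of query.
      set w := (block [relay, relay, add .ptr .ptr .two, load .t₁ .lo .idx, push .t₁,
        load .t₁ .up .idx, push .t₁, readNext .t₁, readNext .t₂]).eval f v with hw
      have hwF : Frame (block [relay, relay, add .ptr .ptr .two, load .t₁ .lo .idx,
        push .t₁, load .t₁ .up .idx, push .t₁, readNext .t₁, readNext .t₂]) v w := frame_eval f _ v
      have hwB : Base P w := hB'.of_frame hwF (by decide) (by decide)
      have hcell : v.arr .input = P.encode.cell := hB'.input
      have hlo := hC'.lo a
      have hup := hC'.up a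
      simp only [ha] at hlo hup
      have hw₁ : w.reg .t₁ = (P.cost 0 a).num := by
        simp [hw, block, relay, readNext, eval, hB'.one, hB'.two, h₁, hcell]
        rw [← c₄]; congr 1
      have hw₂ : w.reg .t₂ = (P.cost 0 a).den := by
        simp [hw, block, relay, readNext, eval, hB'.one, hB'.two, h₁, hcell]
        rw [← c₅]; congr 1
      have hwptr : w.reg .ptr = 2 + P.n + 6 * ((i + 1 : ℕ) : ℤ) := by
        simp [hw, block, relay, readNext, eval, hB'.one, hB'.two, h₁]; ring
      have hwq : w.query = v.query ++
          [((P.tail a : ℕ) : ℤ), ((P.head a : ℕ) : ℤ), (lo a : ℤ), (up a : ℤ)] := by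
        simp [hw, block, relay, readNext, eval, hB'.one, h₁, h₂, hcell, hlo, hup,
          c₀, c₁]
        exact ⟨rfl, rfl, rfl, rfl⟩
      have hwidx : w.reg .idx = i := by rw [hwF.reg _ (by decide), h₂]
      have hwarc : w.reg .arc = u.reg .arc := by rw [hwF.reg _ (by decide), harc]
      have hwcost : (block [relay, relay, add .ptr .ptr .two, load .t₁ .lo .idx, push .t₁,
        load .t₁ .up .idx, push .t₁, readNext .t₁, readNext .t₂] : Code).cost f τ v = 15 := by
        simp [block, relay, readNext, Cmd.cost]
      obtain ⟨hq, hc⟩ := pushCosts_spec f τ hwB b a hwidx hw₁ hw₂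
      have hcF := frame_eval f (pushCosts b) w
      have he : (pushArc b).eval f v = (add .idx .idx .one).eval f ((pushCosts b).eval f w) := rfl
      have hce : (pushArc b).cost f τ v = 15 + ((pushCosts b).cost f τ w + 1) := by
        rw [← hwcost]; simp only [pushArc, block, Cmd.cost, hw, eval]; ring
      refine ⟨⟨?_, ?_, ?_⟩, by omega⟩
      · rw [he]
        simp only [eval, set_reg]
        rw [if_neg (by decide), hcF.reg _ (by cases b <;> decide), hwptr]
      · rw [he]
        simp only [eval, set_reg, if_true]
        rw [hcF.reg _ (by cases b <;> decide), hcF.reg _ (by cases b <;> decide), hwidx, hwB.one]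
        norm_num
      · rw [he]
        simp only [eval, set_query]
        rw [hq, hwq, h₃, hwarc, List.take_add_one]
        simp [hi, ha])
  refine ⟨?_, this.2⟩
  rw [this.1.2.2, List.take_of_length_le (by simp)]

theorem query_spec {P : MCIF 1} {lo up : Fin P.m → ℕ} {u : Config Var Arr}
    (hB : Base P u) (hC : Caps P lo up u) (hu : u.query = []) (b : Bool) {q : Word}
    (hq : P.encodeWith lo up (costWord P (u.reg .arc) b) = q) :
    ((query b).eval f u).query = [] ∧
      ((query b).eval f u).res = (f q).out.flatten ++ (f q).current ∧
      ((query b).eval f u).count = (f q).out.length ∧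
      (query b).cost f τ u ≤ 26 * (P.n + P.m + 1) + τ q := by
  set c₁ : Code := block [const .ptr 0, relay, relay] with hc₁
  set u₁ := c₁.eval f u with hu₁
  have hF₁ : Frame c₁ u u₁ := frame_eval f _ u
  have hB₁ : Base P u₁ := hB.of_frame hF₁ (by decide) (by decide)
  have hptr : u₁.reg .ptr = 2 := by
    simp [hu₁, hc₁, block, relay, readNext, eval, hB.one]
  have hq₁ : u₁.query = [(P.n : ℤ), (P.m : ℤ)] := by
    simp [hu₁, hc₁, block, relay, readNext, eval, hB.one, hB.input, hu, P.encode_cell_n,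
      P.encode_cell_m]
  obtain ⟨⟨hptr₂, hq₂⟩, ht₂⟩ := relay_nodes_spec f τ hB₁ hptr
  set u₂ := (loop .n relay).eval f u₁ with hu₂
  have hF₂ : Frame (loop .n relay) u₁ u₂ := frame_eval f _ u₁
  set u₃ := u₂.set .idx 0 with hu₃
  have hF₃ : Frame (const .idx 0) u₂ u₃ := frame_eval f (const .idx 0) u₂
  have hB₃ : Base P u₃ :=
    (hB₁.of_frame hF₂ (by decide) (by decide)).of_frame hF₃ (by decide) (by decide)
  have hC₃ : Caps P lo up u₃ := ((hC.of_frame hF₁ (by decide) (by decide)).of_frame hF₂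
    (by decide) (by decide)).of_frame hF₃ (by decide) (by decide)
  have harc : u₃.reg .arc = u.reg .arc := by
    rw [hF₃.reg _ (by decide), hF₂.reg _ (by decide), hF₁.reg _ (by decide)]
  obtain ⟨hq₄, ht₄⟩ := pushArc_loop_spec f τ hB₃ hC₃ b (by simpa [hu₃] using hptr₂) (by simp [hu₃])
  set u₄ := (loop .m (pushArc b)).eval f u₃ with hu₄
  have hq₄' : u₄.query = q := by
    rw [hq₄, harc, hu₃, set_query, hq₂, hq₁, ← hq]
    rfl
  have he : (query b).eval f u = u₄.call f := rfl
  have hce : (query b).cost f τ u = c₁.cost f τ u + (loop .n relay).cost f τ u₁ + 1 +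
      (loop .m (pushArc b)).cost f τ u₃ + (1 + τ u₄.query) := by
    simp only [query, block, Cmd.cost, hc₁, hu₁, hu₂, hu₃, hu₄, eval]; ring
  have ht₁ : c₁.cost f τ u = 7 := by simp [hc₁, block, relay, readNext, Cmd.cost]
  rw [he]
  refine ⟨rfl, ?_, ?_, ?_⟩
  · rw [← hq₄']; rfl
  · rw [← hq₄']; rfl
  · rw [hce, hq₄', ht₁]; omega

theorem reset_spec {P : MCIF 1} {u : Config Var Arr} (hB : Base P u) :
    Caps P P.lower P.upper (reset.eval f u) ∧ reset.cost f τ u ≤ 11 * P.m + 3 := by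
  set u₁ := ((add .ptr .two .n).eval f u).set .idx 0 with hu₁
  have hF₁ : Frame (block [add .ptr .two .n, const .idx 0]) u u₁ :=
    frame_eval f (block [add .ptr .two .n, const .idx 0]) u
  have hB₁ : Base P u₁ := hB.of_frame hF₁ (by decide) (by decide)
  have := Cmd.loop_spec f τ (c := resetArc) hB₁.m (fun i v => v.reg .ptr = 2 + P.n + 6 * i ∧
    v.reg .idx = i ∧ ∀ a : Fin P.m, (a : ℕ) < i →
      v.arr .lo (a : ℕ) = P.lower a ∧ v.arr .up (a : ℕ) = P.upper a) 10
    (by simp [hu₁, eval, hB.two, hB.n]) (by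
      intro i hi v hF hI
      have hB' := hB₁.of_frame hF (by decide) (by decide)
      obtain ⟨h₁, h₂, h₃⟩ := hI
      have c := P.encode_cell_arc ⟨i, hi⟩
      have c₂ := c 2 (by norm_num)
      have c₃ := c 3 (by norm_num)
      simp at c₂ c₃
      refine ⟨⟨?_, ?_, fun a ha => ?_⟩, ?_⟩
      · simp [resetArc, block, readNext, eval, hB'.one, hB'.two, h₁]; ring
      · simp [resetArc, block, readNext, eval, hB'.one, h₂]
      · rcases Nat.lt_succ_iff_lt_or_eq.mp ha with ha | ha
        · have hne : ¬ ((a : ℕ) : ℤ) = i := by omega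
          simp [resetArc, block, readNext, eval, h₂, hne, h₃ a ha]
        · have : a = ⟨i, hi⟩ := Fin.ext ha
          subst this
          simp [resetArc, block, readNext, eval, h₁, h₂, hB'.one, hB'.two, hB'.input, ← c₂, ← c₃]
          ring_nf
      · simp [resetArc, block, readNext, Cmd.cost])
  have he : reset.eval f u = (loop .m resetArc).eval f u₁ := rfl
  have hce : reset.cost f τ u = 2 + (loop .m resetArc).cost f τ u₁ := by
    simp only [reset, block, Cmd.cost, hu₁, eval]; ring
  rw [he, hce]
  exact ⟨⟨fun a => (this.1.2.2 a a.2).1, fun a => (this.1.2.2 a a.2).2⟩, by omega⟩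

/-- The result consists of the encodings of the values in `l`. -/
structure Result (l : List ℚ) (u : Config Var Arr) : Prop where
  count : u.count = l.length
  num : ∀ (i : ℕ) (hi : i < l.length), u.res.cell (4 * i) = l[i].num
  den : ∀ (i : ℕ) (hi : i < l.length), u.res.cell (4 * i + 1) = l[i].den

theorem Result.of_frame {l : List ℚ} {u v : Config Var Arr}
    (h : Result l u) {c : Code} (hF : c.Frame u v) (hc : c.callFree = true) : Result l v := by
  obtain ⟨_, h₁, h₂⟩ := hF.query hc
  exact ⟨h₂.trans h.count, by rw [h₁]; exact h.num, by rw [h₁]; exact h.den⟩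

/-- Rationals in lowest terms are equal iff numerators and denominators are, so integer comparisons
suffice. Only the first two of the four entries of each word matter, the others encode `-r`. -/
theorem search_spec {P : MCIF 1} {u : Config Var Arr} (hB : Base P u) {l : List ℚ}
    (hR : Result l u) {r : ℚ} (hn : u.reg .num = r.num) (hd : u.reg .den = r.den) :
    (0 < (search.eval f u).reg .found ↔ r ∈ l) ∧ search.cost f τ u ≤ 10 * l.length + 4 := by
  set u₁ := (block [const .found 0, const .j 0, count .k] : Code).eval f u with hu₁
  have hF₁ : Frame (block [const .found 0, const .j 0, count .k]) u u₁ :=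
    frame_eval f (block [const .found 0, const .j 0, count .k]) u
  have hB₁ : Base P u₁ := hB.of_frame hF₁ (by decide) (by decide)
  have hR₁ : Result l u₁ := hR.of_frame hF₁ (by decide)
  have hk : u₁.reg .k = l.length := by simp [hu₁, block, eval, hR.count]
  have := Cmd.loop_spec f τ (c := searchStep) hk (fun i v => v.reg .j = 4 * i ∧
    (0 < v.reg .found ↔ r ∈ l.take i)) 9
    (by simp [hu₁, block, eval]) (by
      intro i hi v hF hI
      have hB' := hB₁.of_frame hF (by decide) (by decide)
      have hR' := hR₁.of_frame hF (by decide)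
      obtain ⟨h₁, h₂⟩ := hI
      have hnum : v.reg .num = r.num := by
        rw [hF.reg _ (by decide), hF₁.reg _ (by decide), hn]
      have hden : v.reg .den = r.den := by
        rw [hF.reg _ (by decide), hF₁.reg _ (by decide), hd]
      have e₁ := hR'.num i hi
      have e₂ := hR'.den i hi
      refine ⟨⟨?_, ?_⟩, ?_⟩
      · simp only [searchStep, block, eval, set_reg, set_res, h₁, hB'.one, hB'.three, e₁,
          e₂, hnum, hden, reduceCtorEq, if_true, if_false]
        split_ifs <;> simp <;> ring
      · have hmem : r ∈ l.take (i + 1) ↔ r ∈ l.take i ∨ l[i] = r := by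
          rw [← List.take_concat_get' l i hi, List.mem_append, List.mem_singleton, eq_comm (a := r)]
        have hr : l[i] = r ↔ l[i].num = r.num ∧ l[i].den = r.den :=
          ⟨by rintro rfl; exact ⟨rfl, rfl⟩, fun h => Rat.ext h.1 h.2⟩
        rw [hmem, hr, ← h₂]
        have hden' : (l[i].den : ℤ) = r.den ↔ l[i].den = r.den := Nat.cast_inj
        simp only [searchStep, block, eval, set_reg, set_res, h₁, hB'.one, hB'.three, e₁,
          e₂, hnum, hden, reduceCtorEq, if_true, if_false, hden']
        split_ifs <;> simp_all
      · simp only [searchStep, block, Cmd.cost]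
        split_ifs <;> omega)
  have he : search.eval f u = (loop .k searchStep).eval f u₁ := rfl
  have hce : search.cost f τ u = 3 + (loop .k searchStep).cost f τ u₁ := by
    simp only [search, block, Cmd.cost, hu₁, eval]; ring
  rw [he, hce]
  refine ⟨?_, by omega⟩
  rw [this.1.2, List.take_length]

/-- The values in `l` have been saved. -/
structure Saved (l : List ℚ) (u : Config Var Arr) : Prop where
  num : ∀ (i : ℕ) (hi : i < l.length), u.arr .num i = l[i].num
  den : ∀ (i : ℕ) (hi : i < l.length), u.arr .den i = l[i].den

/-- The values are copied to arrays of the host because the next call replaces the answer. -/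
theorem save_spec {P : MCIF 1} {u : Config Var Arr} (hB : Base P u) {l : List ℚ}
    (hR : Result l u) :
    Saved l (save.eval f u) ∧ (save.eval f u).reg .total = l.length ∧
      save.cost f τ u ≤ 8 * l.length + 4 := by
  set c₁ : Code := block [count .total, const .j 0, const .val 0] with hc₁
  set u₁ := c₁.eval f u with hu₁
  have hF₁ : Frame c₁ u u₁ := frame_eval f c₁ u
  have hB₁ : Base P u₁ := hB.of_frame hF₁ (by decide) (by decide)
  have hR₁ : Result l u₁ := hR.of_frame hF₁ (by decide)
  have hk : u₁.reg .total = l.length := by simp [hu₁, hc₁, block, eval, hR.count]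
  have := Cmd.loop_spec f τ (c := saveStep) hk (fun i v => v.reg .j = 4 * i ∧ v.reg .val = i ∧
    ∀ (k : ℕ) (hk : k < l.length), k < i → v.arr .num k = l[k].num ∧ v.arr .den k = l[k].den) 7
    (by simp [hu₁, hc₁, block, eval]) (by
      intro i hi v hF hI
      have hB' := hB₁.of_frame hF (by decide) (by decide)
      have hR' := hR₁.of_frame hF (by decide)
      obtain ⟨h₁, h₂, h₃⟩ := hI
      have e₁ := hR'.num i hi
      have e₂ := hR'.den i hi
      refine ⟨⟨?_, ?_, fun k hk hki => ?_⟩, ?_⟩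
      · simp [saveStep, block, eval, hB'.one, hB'.three, h₁]; ring
      · simp [saveStep, block, eval, hB'.one, h₂]
      · rcases Nat.lt_succ_iff_lt_or_eq.mp hki with hki | rfl
        · have hne : ¬ (k : ℤ) = i := by omega
          simp [saveStep, block, eval, h₂, hne, h₃ k hk hki]
        · simp [saveStep, block, eval, h₁, h₂, hB'.one, e₁, e₂]
      · simp [saveStep, block, Cmd.cost])
  have he : save.eval f u = (loop .total saveStep).eval f u₁ := rfl
  have hce : save.cost f τ u = 3 + (loop .total saveStep).cost f τ u₁ := by
    simp only [save, block, Cmd.cost, hc₁, hu₁, eval]; ring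
  rw [he, hce]
  refine ⟨⟨fun i hi => (this.1.2.2 i hi hi).1, fun i hi => (this.1.2.2 i hi hi).2⟩, ?_, by omega⟩
  rw [(frame_eval f (loop .total saveStep) u₁).reg _ (by decide), hk]

end Reduction

end MCIF

/-! ### Halving the interval of an arc with two queries. -/

namespace MCIF

namespace Reduction

open RAM (Cmd Config Word State)
open RAM.Cmd

variable (f : Word → State) (τ : Word → ℕ)

/-- The answers to the queries for the problem `P`, which has the values `l₀`, are correct,
and are found in time `T`. -/
structure Oracle (P : MCIF 1) (l₀ : List ℚ) (T : ℕ) : Prop where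
  values : ∀ lo up : Fin P.m → ℕ, P.lower ≤ lo → up ≤ P.upper →
    (∃ g : Fin P.m → ℤ, (P.restrict lo up).IsFeasible g) →
    τ (P.encodeWith lo up P.oppositeCosts) ≤ T ∧ ∃ l : List ℚ,
      (f (P.encodeWith lo up P.oppositeCosts)).out = l.map (fun r => encodeVector ![r, -r]) ∧
      l.length ≤ l₀.length ∧
      ∀ r, r ∈ l ↔ ∃ g : Fin P.m → ℤ, (P.restrict lo up).IsFeasible g ∧ P.outcome g 0 = r
  minimum : ∀ (lo up : Fin P.m → ℕ) (a : Fin P.m), P.lower ≤ lo → up ≤ P.upper →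
    (∃ g : Fin P.m → ℤ, (P.restrict lo up).IsFeasible g) →
    τ (P.encodeWith lo up (P.arcFlowCosts a)) ≤ T ∧ ∃ g : Fin P.m → ℤ, (P.restrict lo up).IsFeasible g ∧
      (f (P.encodeWith lo up (P.arcFlowCosts a))).out = [encodeVector fun _ : Fin 2 => (g a : ℚ)] ∧
      ∀ g' : Fin P.m → ℤ, (P.restrict lo up).IsFeasible g' → g a ≤ g' a

theorem costWord_true (P : MCIF 1) (a : Fin P.m) :
    costWord P (a : ℕ) true = P.arcFlowCosts a := by
  funext b
  simp [costWord, arcFlowCosts, Fin.ext_iff]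

theorem costWord_false (P : MCIF 1) (z : ℤ) : costWord P z false = P.oppositeCosts := rfl

/-- Although answers are stored without word boundaries, each vector `(r, -r)` takes exactly four
entries, so the one with index `i` starts at position `4 * i`. -/
theorem result_of_out {u : Config Var Arr} {s : State} {l : List ℚ}
    (hs : s.out = l.map (fun r => encodeVector ![r, -r]))
    (hr : u.res = s.out.flatten ++ s.current) (hc : u.count = s.out.length) : Result l u := by
  have key : ∀ (i : ℕ) (hi : i < l.length) (j : ℕ), j < 4 →
      u.res.cell (4 * i + j) = [l[i].num, (l[i].den : ℤ), -l[i].num, (l[i].den : ℤ)].getD j 0 := by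
    intro i hi j hj
    have hl : ∀ r : ℚ, encodeVector ![r, -r] = [r.num, (r.den : ℤ), -r.num, (r.den : ℤ)] := by
      intro r; rw [encodeVector_two]; simp
    rw [hr, hs, ← List.flatMap_def,
      show (4 * (i : ℤ) + j) = ((4 * i + j : ℕ) : ℤ) by push_cast; ring, Word.cell_natCast,
      List.getD_append _ _ _ _ (by
        simp only [List.length_flatMap, hl]
        simp
        omega),
      getD_flatMap _ 4 _ (by simp [hl]) i hi j hj, hl]
  refine ⟨by simp [hc, hs], fun i hi => ?_, fun i hi => ?_⟩
  · simpa using key i hi 0 (by norm_num)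
  · simpa using key i hi 1 (by norm_num)

/-- A flow with cost `r` is being searched for within the capacities `lo` and `up`. -/
structure Inv (P : MCIF 1) (r : ℚ) (lo up : Fin P.m → ℕ) (u : Config Var Arr) : Prop where
  base : Base P u
  caps : Caps P lo up u
  query : u.query = []
  num : u.reg .num = r.num
  den : u.reg .den = r.den
  lower : P.lower ≤ lo
  upper : up ≤ P.upper
  flow : ∃ g : Fin P.m → ℤ, (P.restrict lo up).IsFeasible g ∧ P.outcome g 0 = r

theorem raise_spec {P : MCIF 1} {lo up : Fin P.m → ℕ} {u : Config Var Arr} (hB : Base P u)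
    (hC : Caps P lo up u) {a : Fin P.m} (ha : u.reg .arc = (a : ℕ)) {k : ℕ} (hk : u.reg .mid = k) :
    Caps P (Function.update lo a (k + 1)) up (raise.eval f u) where
  lo b := by
    by_cases h : b = a
    · subst h; simp [raise, eval, ha, hk, hB.one]
    · have : ¬ ((b : ℕ) : ℤ) = (a : ℕ) := by
        rw [Nat.cast_inj]; exact fun h' => h (Fin.ext h')
      simp [raise, eval, ha, h, this, hC.lo]
  up b := by simp [raise, eval, hC.up]

theorem store_up_spec {P : MCIF 1} {lo up : Fin P.m → ℕ} {u : Config Var Arr}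
    (hC : Caps P lo up u) {a : Fin P.m} (ha : u.reg .arc = (a : ℕ)) {x : Var} {k : ℕ}
    (hk : u.reg x = k) :
    Caps P lo (Function.update up a k) ((store .up .arc x : Code).eval f u) where
  lo b := by simp [eval, hC.lo]
  up b := by
    by_cases h : b = a
    · subst h; simp [eval, ha, hk]
    · have : ¬ ((b : ℕ) : ℤ) = (a : ℕ) := by
        rw [Nat.cast_inj]; exact fun h' => h (Fin.ext h')
      simp [eval, ha, h, this, hC.up]

theorem isFeasible_update_lower {P : MCIF 1} {lo up : Fin P.m → ℕ} {a : Fin P.m} {k : ℕ}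
    {g : Fin P.m → ℤ} (h : (P.restrict lo up).IsFeasible g) (hk : (k : ℤ) ≤ g a) :
    (P.restrict (Function.update lo a k) up).IsFeasible g := by
  refine ⟨h.1, fun (b : Fin P.m) => ⟨?_, (h.2 b).2⟩⟩
  change ((Function.update lo a k b : ℕ) : ℤ) ≤ g b
  by_cases hb : b = a
  · subst hb; simpa using hk
  · rw [Function.update_of_ne hb]; exact (h.2 b).1

theorem isFeasible_update_upper {P : MCIF 1} {lo up : Fin P.m → ℕ} {a : Fin P.m} {k : ℕ}
    {g : Fin P.m → ℤ} (h : (P.restrict lo up).IsFeasible g) (hk : g a ≤ (k : ℤ)) :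
    (P.restrict lo (Function.update up a k)).IsFeasible g := by
  refine ⟨h.1, fun (b : Fin P.m) => ⟨(h.2 b).1, ?_⟩⟩
  change g b ≤ ((Function.update up a k b : ℕ) : ℤ)
  by_cases hb : b = a
  · subst hb; simpa using hk
  · rw [Function.update_of_ne hb]; exact (h.2 b).2

variable {f τ}

/-- If the minimum flow on `a` exceeds the midpoint, every flow lies in the upper half. Otherwise
the lower half is feasible, so its values may be enumerated: if `r` occurs, the lower half is kept;
if not, every flow of cost `r` lies in the upper half. Both `[lo, mid]` and `[mid + 1, up]` have
width at most half of the old one, by rounding down. The time is that of two queries and one search.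
-/
theorem bisect_spec {P : MCIF 1} {l₀ : List ℚ} {T : ℕ} (hO : Oracle f τ P l₀ T) {r : ℚ}
    {lo up : Fin P.m → ℕ} {u : Config Var Arr} (h : Inv P r lo up u) {a : Fin P.m}
    (ha : u.reg .arc = (a : ℕ)) :
    (∃ lo' up' : Fin P.m → ℕ, Inv P r lo' up' (bisect.eval f u) ∧
      (∀ b, b ≠ a → lo' b = lo b ∧ up' b = up b) ∧ up' a - lo' a ≤ (up a - lo a) / 2) ∧
      bisect.cost f τ u ≤ 52 * (P.n + P.m + 1) + 10 * l₀.length + 2 * T + 20 := by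
  obtain ⟨g, hg, hgr⟩ := h.flow
  have hlu : lo a ≤ up a := by have := (hg.2 a).1.trans (hg.2 a).2; exact_mod_cast this
  set mid := (lo a + up a) / 2 with hmid
  set c₁ : Code := block [load .lo .lo .arc, load .hi .up .arc, add .mid .lo .hi, half .mid .mid]
    with hc₁
  set u₁ := c₁.eval f u with hu₁
  have hF₁ : Frame c₁ u u₁ := frame_eval f c₁ u
  have hB₁ : Base P u₁ := h.base.of_frame hF₁ (by decide) (by decide)
  have hC₁ : Caps P lo up u₁ := h.caps.of_frame hF₁ (by decide) (by decide)
  have harc₁ : u₁.reg .arc = (a : ℕ) := by rw [hF₁.reg _ (by decide), ha]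
  have hmid₁ : u₁.reg .mid = mid := by
    simp [hu₁, hc₁, block, eval, ha, h.caps.lo, h.caps.up, hmid]
  have hhi₁ : u₁.reg .hi = up a := by simp [hu₁, hc₁, block, eval, ha, h.caps.up]
  have hq₁ : u₁.query = [] := by rw [(hF₁.query (by decide)).1, h.query]
  obtain ⟨ht, g₁, hg₁, hout, hmin⟩ := hO.minimum lo up a h.lower h.upper ⟨g, hg⟩
  obtain ⟨hq₂, hres₂, -, ht₂⟩ := query_spec f τ hB₁ hC₁ hq₁ true
    (q := P.encodeWith lo up (P.arcFlowCosts a)) (by rw [harc₁, costWord_true])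
  set u₂ := (query true).eval f u₁ with hu₂
  have hF₂ : Frame (query true) u₁ u₂ := frame_eval f _ u₁
  -- The first entry of the answer is the numerator of an integer, hence the minimum itself.
  have hcell : u₂.res.cell 0 = g₁ a := by
    rw [hres₂, hout, encodeVector_two]
    simp [Word.cell]
  set c₃ : Code := block [result .t₁ .zero, sub .t₁ .t₁ .mid] with hc₃
  set u₃ := c₃.eval f u₂ with hu₃
  have hF₃ : Frame c₃ u₂ u₃ := frame_eval f c₃ u₂
  have hB₂ : Base P u₂ := hB₁.of_frame hF₂ (by decide) (by decide)
  have hB₃ : Base P u₃ := hB₂.of_frame hF₃ (by decide) (by decide)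
  have hC₃ : Caps P lo up u₃ := (hC₁.of_frame hF₂ (by decide) (by decide)).of_frame hF₃
    (by decide) (by decide)
  have hreg₃ : ∀ x, x ∉ (query true).regs → x ∉ c₃.regs → u₃.reg x = u₁.reg x := fun x h₁ h₂ => by
    rw [hF₃.reg x h₂, hF₂.reg x h₁]
  have harc₃ : u₃.reg .arc = (a : ℕ) := by rw [hreg₃ _ (by decide) (by decide), harc₁]
  have hmid₃ : u₃.reg .mid = mid := by rw [hreg₃ _ (by decide) (by decide), hmid₁]
  have hhi₃ : u₃.reg .hi = up a := by rw [hreg₃ _ (by decide) (by decide), hhi₁]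
  have hnum₃ : u₃.reg .num = r.num := by
    rw [hreg₃ _ (by decide) (by decide), hF₁.reg _ (by decide), h.num]
  have hden₃ : u₃.reg .den = r.den := by
    rw [hreg₃ _ (by decide) (by decide), hF₁.reg _ (by decide), h.den]
  have hq₃ : u₃.query = [] := by rw [(hF₃.query (by decide)).1, hq₂]
  have ht₃ : u₃.reg .t₁ = g₁ a - mid := by
    have : u₂.reg .mid = mid := by rw [hF₂.reg _ (by decide), hmid₁]
    simp [hu₃, hc₃, block, eval, hB₂.zero, hcell, this]
  set c₄ : Code := block [store .up .arc .mid, query false, search,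
      ifPos .found skip (seq (store .up .arc .hi) raise)] with hc₄
  have he : bisect.eval f u = if 0 < u₃.reg .t₁ then raise.eval f u₃ else c₄.eval f u₃ := rfl
  have hce : bisect.cost f τ u = 1 + (1 + (1 + (1 + ((query true).cost f τ u₁ + (1 + (1 +
      (1 + if 0 < u₃.reg .t₁ then raise.cost f τ u₃ else c₄.cost f τ u₃))))))) := rfl
  rw [he, hce]
  -- The passage to the upper half, shared by the two branches that lead to it.
  have hraise : ∀ v : Config Var Arr, Base P v → Caps P lo up v → v.query = [] →
      v.reg .arc = (a : ℕ) → v.reg .mid = mid → v.reg .num = r.num → v.reg .den = r.den →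
      (mid : ℤ) + 1 ≤ g a →
      ∃ lo' up' : Fin P.m → ℕ, Inv P r lo' up' (raise.eval f v) ∧
        (∀ b, b ≠ a → lo' b = lo b ∧ up' b = up b) ∧ up' a - lo' a ≤ (up a - lo a) / 2 := by
    intro v hBv hCv hqv hav hmv hnv hdv hgv
    have hF : Frame raise v (raise.eval f v) := frame_eval f _ v
    refine ⟨Function.update lo a (mid + 1), up, ⟨hBv.of_frame hF (by decide) (by decide),
      raise_spec f hBv hCv hav hmv, by rw [(hF.query (by decide)).1, hqv],
      by rw [hF.reg _ (by decide), hnv], by rw [hF.reg _ (by decide), hdv], fun b => ?_, h.upper,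
      g, isFeasible_update_lower hg (by exact_mod_cast hgv), hgr⟩, fun b hb => ?_, ?_⟩
    · refine (h.lower b).trans ?_
      by_cases hb : b = a
      · subst hb; simp; omega
      · simp [hb]
    · simp [hb]
    · simp; omega
  by_cases hpos : 0 < u₃.reg .t₁
  · rw [if_pos hpos, if_pos hpos]
    rw [ht₃] at hpos
    have hga := hmin g hg
    refine ⟨hraise u₃ hB₃ hC₃ hq₃ harc₃ hmid₃ hnum₃ hden₃ (by omega), ?_⟩
    have : raise.cost f τ u₃ = 2 := by simp [raise, Cmd.cost]
    omega
  · rw [if_neg hpos, if_neg hpos]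
    rw [ht₃] at hpos
    have hmu : mid ≤ up a := by omega
    set up₄ := Function.update up a mid with hup₄
    have hup₄le : up₄ ≤ P.upper := by
      intro b
      by_cases hb : b = a
      · subst hb; simpa [hup₄] using hmu.trans (h.upper b)
      · simpa [hup₄, hb] using h.upper b
    set u₄ := (store .up .arc .mid : Code).eval f u₃ with hu₄
    have hF₄ : Frame (store .up .arc .mid) u₃ u₄ := frame_eval f (store .up .arc .mid) u₃
    have hB₄ : Base P u₄ := hB₃.of_frame hF₄ (by decide) (by decide)
    have hC₄ : Caps P lo up₄ u₄ := store_up_spec f hC₃ harc₃ hmid₃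
    -- The minimizer of the first query certifies that the second query is made on a feasible
    -- instance, which need not be true of the flow `g` of cost `r`.
    have hg₄ : (P.restrict lo up₄).IsFeasible g₁ := isFeasible_update_upper hg₁ (by omega)
    obtain ⟨ht', l, hout', hlen, hmem⟩ := hO.values lo up₄ h.lower hup₄le ⟨g₁, hg₄⟩
    obtain ⟨hq₅, hres₅, hcount₅, ht₅⟩ := query_spec f τ hB₄ hC₄ (hq₃ : u₄.query = []) false
      (q := P.encodeWith lo up₄ P.oppositeCosts) (by rw [costWord_false])
    set u₅ := (query false).eval f u₄ with hu₅
    have hF₅ : Frame (query false) u₄ u₅ := frame_eval f _ u₄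
    have hB₅ : Base P u₅ := hB₄.of_frame hF₅ (by decide) (by decide)
    have hC₅ : Caps P lo up₄ u₅ := hC₄.of_frame hF₅ (by decide) (by decide)
    have hreg₅ : ∀ x, x ∉ (query false).regs → u₅.reg x = u₃.reg x := fun x h₁ => by
      rw [hF₅.reg x h₁]; rfl
    obtain ⟨hfound, ht₆⟩ := search_spec f τ hB₅ (result_of_out hout' hres₅ hcount₅) (r := r)
      (by rw [hreg₅ _ (by decide), hnum₃]) (by rw [hreg₅ _ (by decide), hden₃])
    set u₆ := search.eval f u₅ with hu₆
    have hF₆ : Frame search u₅ u₆ := frame_eval f _ u₅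
    have hB₆ : Base P u₆ := hB₅.of_frame hF₆ (by decide) (by decide)
    have hC₆ : Caps P lo up₄ u₆ := hC₅.of_frame hF₆ (by decide) (by decide)
    have hreg₆ : ∀ x, x ∉ (query false).regs → x ∉ search.regs → u₆.reg x = u₃.reg x :=
      fun x h₁ h₂ => by rw [hF₆.reg x h₂, hreg₅ x h₁]
    have hq₆ : u₆.query = [] := by rw [(hF₆.query (by decide)).1, hq₅]
    have hnum₆ : u₆.reg .num = r.num := by rw [hreg₆ _ (by decide) (by decide), hnum₃]
    have hden₆ : u₆.reg .den = r.den := by rw [hreg₆ _ (by decide) (by decide), hden₃]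
    have harc₆ : u₆.reg .arc = (a : ℕ) := by rw [hreg₆ _ (by decide) (by decide), harc₃]
    have hmid₆ : u₆.reg .mid = mid := by rw [hreg₆ _ (by decide) (by decide), hmid₃]
    have hhi₆ : u₆.reg .hi = up a := by rw [hreg₆ _ (by decide) (by decide), hhi₃]
    have he₄ : c₄.eval f u₃ = if 0 < u₆.reg .found then u₆ else
        raise.eval f ((store .up .arc .hi : Code).eval f u₆) := rfl
    have hce₄ : c₄.cost f τ u₃ = 1 + ((query false).cost f τ u₄ + (search.cost f τ u₅ +
        (1 + if 0 < u₆.reg .found then 1 else 1 + (1 + 1)))) := rfl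
    have hce₄' : c₄.cost f τ u₃ ≤ 1 + (query false).cost f τ u₄ + search.cost f τ u₅ + 4 := by
      rw [hce₄]; split_ifs <;> omega
    refine ⟨?_, by omega⟩
    rw [he₄]
    by_cases hf : 0 < u₆.reg .found
    · rw [if_pos hf]
      obtain ⟨g₂, hg₂, hgr₂⟩ := (hmem r).1 (hfound.1 hf)
      refine ⟨lo, up₄, ⟨hB₆, hC₆, hq₆, hnum₆, hden₆, h.lower, hup₄le, g₂, hg₂, hgr₂⟩,
        fun b hb => ?_, ?_⟩
      · simp [hup₄, hb]
      · simp [hup₄]; omega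
    · rw [if_neg hf]
      set u₇ := (store .up .arc .hi : Code).eval f u₆ with hu₇
      have hF₇ : Frame (store .up .arc .hi) u₆ u₇ := frame_eval f (store .up .arc .hi) u₆
      -- The variable `hi` still holds the old upper capacity, so storing it undoes the tentative
      -- restriction.
      have hC₇ : Caps P lo up u₇ := by
        have := store_up_spec f hC₆ harc₆ hhi₆
        rwa [hup₄, Function.update_idem, Function.update_eq_self] at this
      refine hraise u₇ (hB₆.of_frame hF₇ (by decide) (by decide)) hC₇ hq₆ harc₆ hmid₆ hnum₆ hden₆ ?_
      -- Were `g a ≤ mid`, the flow `g` would be feasible in the lower half and its cost `r` would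
      -- have been found.
      by_contra! hlt
      exact hf (hfound.2 ((hmem r).2 ⟨g, isFeasible_update_upper hg (by omega), hgr⟩))

end Reduction

end MCIF

/-! ### Recovering a flow for every value, and the total running time. -/

namespace MCIF

namespace Reduction

open RAM (Cmd Config Word State)
open RAM.Cmd

variable {f : Word → State} {τ : Word → ℕ}

/-- Time for halving an interval. -/
def bisectTime (P : MCIF 1) (l₀ : List ℚ) (T : ℕ) : ℕ :=
  52 * (P.n + P.m + 1) + 10 * l₀.length + 2 * T + 20

/-- An interval of width `D` is reduced to width 0 by `D.size` halvings, since `D < 2 ^ D.size`. The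
number of rounds is therefore at most the bit length of the upper capacity. -/
theorem fixArc_spec {P : MCIF 1} {l₀ : List ℚ} {T S : ℕ} (hO : Oracle f τ P l₀ T)
    (hS : ∀ a, (P.upper a).size ≤ S) {r : ℚ}
    {lo up : Fin P.m → ℕ} {u : Config Var Arr} (h : Inv P r lo up u) {a : Fin P.m}
    (ha : u.reg .arc = (a : ℕ)) :
    ((∃ lo' up' : Fin P.m → ℕ, Inv P r lo' up' (fixArc.eval f u) ∧
      (∀ b, b ≠ a → lo' b = lo b ∧ up' b = up b) ∧ up' a = lo' a) ∧
      (fixArc.eval f u).reg .arc = ((a : ℕ) + 1 : ℕ)) ∧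
      fixArc.cost f τ u ≤ S + S * (1 + bisectTime P l₀ T) + 6 := by
  obtain ⟨g, hg, -⟩ := h.flow
  have hlu : lo a ≤ up a := by have := (hg.2 a).1.trans (hg.2 a).2; exact_mod_cast this
  set c₁ : Code := block [load .lo .lo .arc, load .hi .up .arc, sub .hi .hi .lo, size .rounds .hi]
    with hc₁
  set u₁ := c₁.eval f u with hu₁
  have hF₁ : Frame c₁ u u₁ := frame_eval f c₁ u
  -- Commands that touch neither capacities, target value, constants nor the query preserve the
  -- invariant.
  have hinv : ∀ {c : Code} {lo up : Fin P.m → ℕ} {v w : Config Var Arr}, Inv P r lo up v →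
      c.Frame v w → (∀ x ∈ [Var.zero, .one, .two, .three, .n, .m], x ∉ c.regs) →
      Arr.input ∉ c.arrs → Arr.lo ∉ c.arrs → Arr.up ∉ c.arrs → c.callFree = true →
      Var.num ∉ c.regs → Var.den ∉ c.regs → Inv P r lo up w :=
    fun hv hF h₁ h₂ h₃ h₄ h₅ h₆ h₇ => ⟨hv.base.of_frame hF h₁ h₂, hv.caps.of_frame hF h₃ h₄,
      (hF.query h₅).1.trans hv.query, (hF.reg _ h₆).trans hv.num, (hF.reg _ h₇).trans hv.den,
      hv.lower, hv.upper, hv.flow⟩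
  have h₁ : Inv P r lo up u₁ := hinv h hF₁ (by decide) (by decide) (by decide) (by decide)
    (by decide) (by decide) (by decide)
  have hD : ((up a : ℤ) - lo a).toNat = up a - lo a := by omega
  have hrounds : u₁.reg .rounds = ((up a - lo a).size : ℕ) := by
    simp [hu₁, hc₁, block, eval, ha, h.caps.lo, h.caps.up, hD]
  have harc₁ : u₁.reg .arc = (a : ℕ) := by rw [hF₁.reg _ (by decide), ha]
  have hcost₁ : c₁.cost f τ u = (up a - lo a).size + 4 := by
    simp [hc₁, block, eval, Cmd.cost, ha, h.caps.lo, h.caps.up, hD]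
    ring
  have hloop := Cmd.loop_spec f τ (c := bisect) hrounds (fun i v =>
    ∃ lo' up' : Fin P.m → ℕ, Inv P r lo' up' v ∧ (∀ b, b ≠ a → lo' b = lo b ∧ up' b = up b) ∧
      up' a - lo' a ≤ (up a - lo a) / 2 ^ i) (bisectTime P l₀ T)
    ⟨lo, up, h₁, fun _ _ => ⟨rfl, rfl⟩, by simp⟩ (by
      rintro i hi v hF ⟨lo', up', hI, heq, hle⟩
      obtain ⟨⟨lo'', up'', hI', heq', hle'⟩, ht⟩ := bisect_spec hO hI
        (a := a) (by rw [hF.reg _ (by decide), harc₁])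
      refine ⟨⟨lo'', up'', hI', fun b hb => ?_, ?_⟩, ht⟩
      · rw [(heq' b hb).1, (heq' b hb).2]; exact heq b hb
      · rw [pow_succ, ← Nat.div_div_eq_div_mul]
        exact hle'.trans (Nat.div_le_div_right hle))
  obtain ⟨⟨lo', up', hI, heq, hle⟩, ht⟩ := hloop
  set u₂ := (loop .rounds bisect).eval f u₁ with hu₂
  have hF₂ : Frame (loop .rounds bisect) u₁ u₂ := frame_eval f _ u₁
  have he : fixArc.eval f u = (add .arc .arc .one).eval f u₂ := rfl
  have hF₃ : Frame (add .arc .arc .one) u₂ (fixArc.eval f u) := he ▸ frame_eval f _ u₂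
  have hce : fixArc.cost f τ u = c₁.cost f τ u + ((loop .rounds bisect).cost f τ u₁ + 1) := by
    have : fixArc.cost f τ u = 1 + (1 + (1 + ((size .rounds .hi : Code).cost f τ _ +
      ((loop .rounds bisect).cost f τ u₁ + 1)))) := rfl
    rw [this]
    have : c₁.cost f τ u = 1 + (1 + (1 + (size .rounds .hi : Code).cost f τ _)) := rfl
    rw [this]
    ring
  -- The width bound uses truncated subtraction and gives only `up' a ≤ lo' a`; the reverse
  -- inequality comes from the existence of a flow.
  obtain ⟨g', hg', -⟩ := hI.flow
  have hlu' : lo' a ≤ up' a := by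
    have := (hg'.2 a).1.trans (hg'.2 a).2; exact_mod_cast this
  rw [Nat.div_eq_of_lt (Nat.lt_size_self _)] at hle
  have hsz : (up a - lo a).size ≤ S :=
    (Nat.size_le_size ((Nat.sub_le _ _).trans (h.upper a))).trans (hS a)
  refine ⟨⟨⟨lo', up', ?_, heq, by omega⟩, ?_⟩, ?_⟩
  · exact hinv hI hF₃ (by decide) (by decide) (by decide) (by decide)
      (by decide) (by decide) (by decide)
  · rw [he]
    simp [eval, hI.base.one]
    rw [hF₂.reg _ (by decide), harc₁]
  · rw [hce, hcost₁]
    have := Nat.mul_le_mul_right (1 + bisectTime P l₀ T) hsz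
    omega

theorem writeArc_loop_spec {P : MCIF 1} {lo up : Fin P.m → ℕ} {u : Config Var Arr}
    (hB : Base P u) (hC : Caps P lo up u) (hidx : u.reg .idx = 0) (hcur : u.current = []) :
    ((loop .m writeArc).eval f u).current = encodeFlow (fun a => (lo a : ℤ)) ∧
      ((loop .m writeArc).eval f u).out = u.out ∧
      (loop .m writeArc).cost f τ u ≤ 1 + P.m * (1 + 3) := by
  have := Cmd.loop_spec f τ (c := writeArc) hB.m (fun i v => v.reg .idx = i ∧
    v.current = (List.ofFn fun a => (lo a : ℤ)).take i ∧ v.out = u.out) 3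
    ⟨by simp [hidx], by simp [hcur], rfl⟩ (by
      intro i hi v hF ⟨h₁, h₂, h₃⟩
      have hB' := hB.of_frame hF (by decide) (by decide)
      have hC' := hC.of_frame hF (by decide) (by decide)
      have hlo := hC'.lo ⟨i, hi⟩
      simp only at hlo
      refine ⟨⟨?_, ?_, ?_⟩, ?_⟩
      · simp [writeArc, block, eval, h₁, hB'.one]
      · rw [List.take_add_one]
        simp [writeArc, block, eval, Config.set, h₁, h₂, hlo, hi]
      · exact h₃
      · simp [writeArc, block, Cmd.cost])
  refine ⟨?_, this.1.2.2, this.2⟩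
  rw [this.1.2.1, List.take_of_length_le (by simp)]
  rfl

/-- Time for finding a flow. -/
def findTime (P : MCIF 1) (l₀ : List ℚ) (T S : ℕ) : ℕ :=
  P.m * (1 + (S + S * (1 + bisectTime P l₀ T) + 6)) + 15 * P.m + 8

/-- Once every arc has `lo = up`, the flow of cost `r` guaranteed by the invariant equals `lo`, so
writing out the array `lo` outputs it. -/
theorem findFlow_spec {P : MCIF 1} {l₀ : List ℚ} {T S : ℕ} (hO : Oracle f τ P l₀ T)
    (hS : ∀ a, (P.upper a).size ≤ S) {r : ℚ} {u : Config Var Arr} (hB : Base P u)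
    (hq : u.query = []) (hn : u.reg .num = r.num) (hd : u.reg .den = r.den)
    (hcur : u.current = [])
    (hr : ∃ g : Fin P.m → ℤ, P.IsFeasible g ∧ P.outcome g 0 = r) :
    ((findFlow.eval f u).query = [] ∧ (findFlow.eval f u).current = [] ∧
      ∃ g : Fin P.m → ℤ, P.IsFeasible g ∧ P.outcome g 0 = r ∧
        (findFlow.eval f u).out = u.out ++ [encodeFlow g]) ∧
      findFlow.cost f τ u ≤ findTime P l₀ T S := by
  obtain ⟨hC₁, ht₁⟩ := reset_spec f τ hB
  set u₁ := reset.eval f u with hu₁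
  have hF₁ : Frame reset u u₁ := frame_eval f _ u
  set u₂ := u₁.set .arc 0 with hu₂
  have hF₂ : Frame (const .arc 0) u₁ u₂ := frame_eval f (const .arc 0) u₁
  have hI₂ : Inv P r P.lower P.upper u₂ :=
    ⟨(hB.of_frame hF₁ (by decide) (by decide)).of_frame hF₂ (by decide) (by decide),
      hC₁.of_frame hF₂ (by decide) (by decide),
      (hF₂.query (by decide)).1.trans ((hF₁.query (by decide)).1.trans hq),
      (hF₂.reg _ (by decide)).trans ((hF₁.reg _ (by decide)).trans hn),
      (hF₂.reg _ (by decide)).trans ((hF₁.reg _ (by decide)).trans hd), le_rfl, le_rfl, hr⟩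
  obtain ⟨⟨h₃, lo, up, hI₃, heq⟩, ht₃⟩ := Cmd.loop_spec f τ (c := fixArc) hI₂.base.m
    (fun i v => v.reg .arc = i ∧ ∃ lo up : Fin P.m → ℕ, Inv P r lo up v ∧
      ∀ b : Fin P.m, (b : ℕ) < i → up b = lo b) (S + S * (1 + bisectTime P l₀ T) + 6)
    ⟨by simp [hu₂], _, _, hI₂, by simp⟩ (by
      rintro i hi v hF ⟨ha, lo, up, hI, heq⟩
      obtain ⟨⟨⟨lo', up', hI', h₁, h₂⟩, h₃⟩, ht⟩ := fixArc_spec hO hS hI (a := ⟨i, hi⟩) ha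
      refine ⟨⟨h₃, lo', up', hI', fun b hb => ?_⟩, ht⟩
      by_cases hbi : b = ⟨i, hi⟩
      · rw [hbi, h₂]
      · rw [(h₁ b hbi).1, (h₁ b hbi).2]
        refine heq b ?_
        have : (b : ℕ) ≠ i := fun h => hbi (Fin.ext h)
        omega)
  set u₃ := (loop .m fixArc).eval f u₂ with hu₃
  have hF₃ : Frame (loop .m fixArc) u₂ u₃ := frame_eval f _ u₂
  set u₄ := u₃.set .idx 0 with hu₄
  have hF₄ : Frame (const .idx 0) u₃ u₄ := frame_eval f (const .idx 0) u₃
  have hcur₄ : u₄.current = [] ∧ u₄.out = u.out := by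
    rw [(hF₄.out (by decide)).1, (hF₃.out (by decide)).1, (hF₂.out (by decide)).1,
      (hF₁.out (by decide)).1, (hF₄.out (by decide)).2, (hF₃.out (by decide)).2,
      (hF₂.out (by decide)).2, (hF₁.out (by decide)).2]
    exact ⟨hcur, rfl⟩
  obtain ⟨hw, hout, ht₅⟩ := writeArc_loop_spec (f := f) (τ := τ)
    (hI₃.base.of_frame hF₄ (by decide) (by decide)) (hI₃.caps.of_frame hF₄ (by decide) (by decide))
    (by simp [hu₄]) hcur₄.1
  set u₅ := (loop .m writeArc).eval f u₄ with hu₅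
  have hF₅ : Frame (loop .m writeArc) u₄ u₅ := frame_eval f _ u₄
  have he : findFlow.eval f u = { u₅ with current := [], out := u₅.out ++ [u₅.current] } := rfl
  have hce : findFlow.cost f τ u = reset.cost f τ u + (1 + ((loop .m fixArc).cost f τ u₂ +
    (1 + ((loop .m writeArc).cost f τ u₄ + 1)))) := rfl
  obtain ⟨g, hg, hgr⟩ := hI₃.flow
  have hlo : (fun a => (lo a : ℤ)) = g := by
    funext a
    have h₁ := hg.2 a
    have h₂ := heq a a.2
    change (lo a : ℤ) ≤ g a ∧ g a ≤ up a at h₁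
    omega
  refine ⟨⟨?_, ?_, g, isFeasible_of_restrict hg hI₃.lower hI₃.upper, hgr, ?_⟩, ?_⟩
  · rw [he]
    exact (hF₅.query (by decide)).1.trans hI₃.query
  · rw [he]
  · rw [he]
    simp only
    rw [hw, hout, hcur₄.2, hlo]
  · rw [hce, findTime]
    omega

/-- Time of the reduction. -/
def mainTime (P : MCIF 1) (l₀ : List ℚ) (T S : ℕ) : ℕ :=
  l₀.length * (findTime P l₀ T S + 4) + 8 * l₀.length + 26 * (P.n + P.m + 1) + T + 11 * P.m + 20

/-- One flow is output per enumerated value, in the order of the enumeration; the loop invariant is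
that the flows output so far realize an initial segment of `l₀`. -/
theorem main_spec {P : MCIF 1} {l₀ : List ℚ} {T S : ℕ} (hO : Oracle f τ P l₀ T)
    (hS : ∀ a, (P.upper a).size ≤ S)
    (hl₀ : (f (P.encodeWith P.lower P.upper P.oppositeCosts)).out =
      l₀.map (fun r => encodeVector ![r, -r]))
    (hr : ∀ r ∈ l₀, ∃ g : Fin P.m → ℤ, P.IsFeasible g ∧ P.outcome g 0 = r)
    (hne : ∃ g : Fin P.m → ℤ, P.IsFeasible g) :
    (∃ gs : List (Fin P.m → ℤ), (main.eval f (.init .input P.encode)).out = gs.map encodeFlow ∧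
      (∀ g ∈ gs, P.IsFeasible g) ∧ gs.map (fun g => P.outcome g 0) = l₀) ∧
      main.cost f τ (.init .input P.encode) ≤ mainTime P l₀ T S := by
  set u : Config Var Arr := .init .input P.encode with hu
  set u₁ := start.eval f u with hu₁
  have hF₁ : Frame start u u₁ := frame_eval f _ u
  have hB₁ : Base P u₁ := by
    constructor <;> simp [hu₁, hu, start, block, readNext, eval, Config.init, P.encode_cell_n,
      P.encode_cell_m]
  have ht₁ : start.cost f τ u = 7 := by simp [start, block, readNext, Cmd.cost]
  obtain ⟨hC₂, ht₂⟩ := reset_spec f τ hB₁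
  set u₂ := reset.eval f u₁ with hu₂
  have hF₂ : Frame reset u₁ u₂ := frame_eval f _ u₁
  have hB₂ : Base P u₂ := hB₁.of_frame hF₂ (by decide) (by decide)
  have hq₂ : u₂.query = [] := by
    rw [(hF₂.query (by decide)).1, (hF₁.query (by decide)).1]; rfl
  obtain ⟨hτ, -⟩ := hO.values P.lower P.upper le_rfl le_rfl hne
  obtain ⟨hq₃, hres₃, hcount₃, ht₃⟩ := query_spec f τ hB₂ hC₂ hq₂ false
    (q := P.encodeWith P.lower P.upper P.oppositeCosts) (by rw [costWord_false])
  set u₃ := (query false).eval f u₂ with hu₃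
  have hF₃ : Frame (query false) u₂ u₃ := frame_eval f _ u₂
  have hB₃ : Base P u₃ := hB₂.of_frame hF₃ (by decide) (by decide)
  obtain ⟨hsave, htot, ht₄⟩ := save_spec f τ hB₃ (result_of_out hl₀ hres₃ hcount₃)
  set u₄ := save.eval f u₃ with hu₄
  have hF₄ : Frame save u₃ u₄ := frame_eval f _ u₃
  have hB₄ : Base P u₄ := hB₃.of_frame hF₄ (by decide) (by decide)
  set u₅ := u₄.set .val 0 with hu₅
  have hF₅ : Frame (const .val 0) u₄ u₅ := frame_eval f (const .val 0) u₄
  have hB₅ : Base P u₅ := hB₄.of_frame hF₅ (by decide) (by decide)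
  have hout₅ : u₅.current = [] ∧ u₅.out = [] := by
    rw [(hF₅.out (by decide)).1, (hF₄.out (by decide)).1, (hF₃.out (by decide)).1,
      (hF₂.out (by decide)).1, (hF₁.out (by decide)).1, (hF₅.out (by decide)).2,
      (hF₄.out (by decide)).2, (hF₃.out (by decide)).2, (hF₂.out (by decide)).2,
      (hF₁.out (by decide)).2]
    exact ⟨rfl, rfl⟩
  have hq₅ : u₅.query = [] := by
    rw [(hF₅.query (by decide)).1, (hF₄.query (by decide)).1, hq₃]
  have htot₅ : u₅.reg .total = l₀.length := by rw [hF₅.reg _ (by decide), htot]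
  obtain ⟨⟨-, -, -, gs, h₁, h₂, h₃⟩, ht⟩ := Cmd.loop_spec f τ (c := solveStep) htot₅ (fun i v =>
    v.reg .val = i ∧ v.query = [] ∧ v.current = [] ∧
      ∃ gs : List (Fin P.m → ℤ), v.out = gs.map encodeFlow ∧ (∀ g ∈ gs, P.IsFeasible g) ∧
        gs.map (fun g => P.outcome g 0) = l₀.take i) (findTime P l₀ T S + 3)
    ⟨by simp [hu₅], hq₅, hout₅.1, [], by simp [hout₅.2], by simp, by simp⟩ (by
      rintro i hi v hF ⟨hval, hq, hcur, gs, h₁, h₂, h₃⟩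
      have hB := hB₅.of_frame hF (by decide) (by decide)
      set w := (block [load .num .num .val, load .den .den .val] : Code).eval f v with hw
      have hFw : Frame (block [load .num .num .val, load .den .den .val]) v w := frame_eval f _ v
      have hnum : w.reg .num = l₀[i].num := by
        simp only [hw, block, eval, set_reg, reduceCtorEq, if_false, if_true]
        rw [hval, hF.arr _ (by decide)]; exact hsave.num i hi
      have hden : w.reg .den = l₀[i].den := by
        simp only [hw, block, eval, set_reg, reduceCtorEq, if_false, if_true, set_arr]
        rw [hval, hF.arr _ (by decide)]; exact hsave.den i hi
      obtain ⟨⟨hq', hcur', g, hg, hgr, hout⟩, ht⟩ := findFlow_spec hO hS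
        (hB.of_frame hFw (by decide) (by decide)) ((hFw.query (by decide)).1.trans hq) hnum hden
        ((hFw.out (by decide)).1.trans hcur) (hr _ (List.getElem_mem hi))
      set x := findFlow.eval f w with hx
      have hFx : Frame findFlow w x := frame_eval f _ w
      have he : solveStep.eval f v = x.set .val (x.reg .val + x.reg .one) := rfl
      have hce : solveStep.cost f τ v = 1 + (1 + (findFlow.cost f τ w + 1)) := rfl
      have hone : x.reg .one = 1 := by
        rw [hFx.reg _ (by decide), hFw.reg _ (by decide), hB.one]
      refine ⟨⟨?_, ?_, ?_, gs ++ [g], ?_, ?_, ?_⟩, ?_⟩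
      · rw [he, set_reg, if_pos rfl, hone, hFx.reg _ (by decide), hFw.reg _ (by decide), hval]
        push_cast; rfl
      · rw [he]; exact hq'
      · rw [he]; exact hcur'
      · rw [he, List.map_append, ← h₁, ← (hFw.out (by decide)).2]; exact hout
      · intro g' hg'
        rcases List.mem_append.mp hg' with hg' | hg'
        · exact h₂ g' hg'
        · rw [List.mem_singleton.mp hg']; exact hg
      · rw [List.map_append, h₃, ← List.take_concat_get' l₀ i hi, ← hgr]
        rfl
      · rw [hce]; omega)
  have hce : main.cost f τ u = start.cost f τ u + (reset.cost f τ u₁ + ((query false).cost f τ u₂ +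
    (save.cost f τ u₃ + (1 + (loop .total solveStep).cost f τ u₅)))) := rfl
  refine ⟨⟨gs, h₁, h₂, by rw [h₃, List.take_length]⟩, ?_⟩
  rw [hce, mainTime]
  rw [show 1 + (findTime P l₀ T S + 3) = findTime P l₀ T S + 4 by ring] at ht
  omega

/-- With `N` dominating all parameters, a bisection takes `O(N (1 + T))`. Rounds per arc, arcs per
flow and the number of values each contribute another factor `N`. -/
theorem mainTime_le {P : MCIF 1} {l₀ : List ℚ} {T S N : ℕ} (hN : 1 ≤ N) (hS : S ≤ N)
    (hl : l₀.length ≤ N) (hn : P.n + P.m + 1 ≤ N) : mainTime P l₀ T S ≤ 300 * N ^ 4 * (1 + T) := by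
  have hNN : ∀ k, 1 ≤ N ^ k := fun k => Nat.one_le_pow _ _ hN
  have hb : bisectTime P l₀ T ≤ 84 * N * (1 + T) := by
    unfold bisectTime; nlinarith [Nat.zero_le (N * T), Nat.mul_le_mul_right T hN]
  have hf₁ : S + S * (1 + bisectTime P l₀ T) + 6 ≤ 92 * N ^ 2 * (1 + T) := by
    have h₁ := Nat.mul_le_mul hS (Nat.add_le_add_left hb 1)
    have h₂ : N ≤ N ^ 2 := by nlinarith
    nlinarith [Nat.zero_le (N ^ 2 * T)]
  have hf : findTime P l₀ T S ≤ 120 * N ^ 3 * (1 + T) := by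
    unfold findTime
    have h₁ := Nat.mul_le_mul (show P.m ≤ N by omega) (Nat.add_le_add_left hf₁ 1)
    have h₂ : N ≤ N ^ 3 := by nlinarith [hNN 2]
    have h₃ : N * (1 + 92 * N ^ 2 * (1 + T)) = N + 92 * N ^ 3 * (1 + T) := by ring
    nlinarith [Nat.zero_le (N ^ 3 * T)]
  unfold mainTime
  have h₁ := Nat.mul_le_mul hl (Nat.add_le_add_right hf 4)
  have h₂ : N ≤ N ^ 4 := by nlinarith [hNN 3]
  have h₃ : N * (120 * N ^ 3 * (1 + T) + 4) = 120 * N ^ 4 * (1 + T) + 4 * N := by ring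
  nlinarith [Nat.zero_le (N ^ 4 * T), Nat.mul_le_mul_right T (hNN 4)]

/-- Registers of the variables. -/
def varCode : Var ↪ ℕ :=
  -- The shift keeps register 0 free, which initially holds the input length instead of zero.
  ⟨fun x => x.ctorIdx + 1, fun a b h => by
    simpa [Var.ofNat_ctorIdx] using congrArg Var.ofNat (Nat.succ_injective h)⟩

/-- Numbers of the arrays. -/
def arrCode : Arr ↪ ℕ :=
  ⟨fun x => x.ctorIdx, fun a b h => by
    simpa [Arr.ofNat_ctorIdx] using congrArg Arr.ofNat h⟩

/-- Flows of a restricted problem are flows of `P`, so a value query has at most `l₀.length`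
answers, and a minimum query has one. As all query encodings are at most four times as long as the
input, a single time bound serves every query. -/
theorem oracle_of_enumeration {c k : ℕ}
    (hf : ∀ Q : Instance 2, (f Q.encode).out.Nodup ∧
      (∀ w, w ∈ (f Q.encode).out ↔ w ∈ encodeVector '' Q.1.supportedNondominated) ∧
      τ Q.encode ≤ c * (Q.encode.size + (f Q.encode).out.length + 1) ^ k)
    (P : MCIF 1) (hP : P.IsAdmissible) :
    ∃ l₀ : List ℚ, l₀.Nodup ∧
      (f (P.encodeWith P.lower P.upper P.oppositeCosts)).out =
        l₀.map (fun r => encodeVector ![r, -r]) ∧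
      (∀ r, r ∈ l₀ ↔ ∃ g : Fin P.m → ℤ, P.IsFeasible g ∧ P.outcome g 0 = r) ∧
      Oracle f τ P l₀ (c * (4 * P.encode.size + l₀.length + 1) ^ k) := by
  have hopp : ∀ lo up : Fin P.m → ℕ,
      (∃ g : Fin P.m → ℤ, (P.restrict lo up).IsFeasible g) →
      ∃ l : List ℚ, l.Nodup ∧ (f (P.encodeWith lo up P.oppositeCosts)).out =
          l.map (fun r => encodeVector ![r, -r]) ∧
        (∀ r, r ∈ l ↔ ∃ g : Fin P.m → ℤ, (P.restrict lo up).IsFeasible g ∧ P.outcome g 0 = r) ∧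
        τ (P.encodeWith lo up P.oppositeCosts) ≤
          c * ((P.encodeWith lo up P.oppositeCosts).size + l.length + 1) ^ k := by
    intro lo up hne
    -- Connectedness is inherited because the graph is the same; feasibility is the hypothesis
    -- `hne`.
    obtain ⟨h₁, h₂, h₃⟩ := hf ⟨(P.restrict lo up).opposite, hP.1, hne⟩
    change (f (P.restrict lo up).opposite.encode).out.Nodup at h₁
    change ∀ w, w ∈ (f (P.restrict lo up).opposite.encode).out ↔
      w ∈ encodeVector '' (P.restrict lo up).opposite.supportedNondominated at h₂
    change τ (P.restrict lo up).opposite.encode ≤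
      c * ((P.restrict lo up).opposite.encode.size +
        (f (P.restrict lo up).opposite.encode).out.length + 1) ^ k at h₃
    rw [encode_opposite] at h₁ h₂ h₃
    have hinj : Function.Injective fun r : ℚ => encodeVector ![r, -r] := by
      intro r r' h
      simp only [encodeVector_two, List.cons.injEq] at h
      exact Rat.ext h.1 (by exact_mod_cast h.2.1)
    -- Every output word encodes some `(r, -r)`, so the whole output is the image of a list of
    -- rationals.
    have hrange : (f (P.encodeWith lo up P.oppositeCosts)).out ∈
        Set.range (List.map fun r : ℚ => encodeVector ![r, -r]) := by
      rw [Set.range_list_map]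
      intro w hw
      obtain ⟨y, hy, rfl⟩ := (h₂ w).1 hw
      obtain ⟨g, -, rfl⟩ := (mem_opposite_supportedNondominated _ _).1 hy
      exact ⟨_, rfl⟩
    obtain ⟨l, hl⟩ := hrange
    refine ⟨l, (hl ▸ h₁).of_map _, hl.symm, fun r => ?_, ?_⟩
    · rw [← List.mem_map_of_injective hinj, hl, h₂]
      constructor
      · rintro ⟨y, hy, hyr⟩
        obtain ⟨g, hg, rfl⟩ := (mem_opposite_supportedNondominated _ _).1 hy
        exact ⟨g, hg, hinj hyr⟩
      · rintro ⟨g, hg, rfl⟩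
        exact ⟨_, (mem_opposite_supportedNondominated _ _).2 ⟨g, hg, rfl⟩, rfl⟩
    · rwa [← hl, List.length_map] at h₃
  obtain ⟨l₀, hnd, hout, hmem, -⟩ := hopp P.lower P.upper hP.2
  have hle : ∀ lo up : Fin P.m → ℕ, (∃ g : Fin P.m → ℤ, (P.restrict lo up).IsFeasible g) →
      lo ≤ up := by
    rintro lo up ⟨g, hg⟩ a
    have := (hg.2 a).1.trans (hg.2 a).2
    exact_mod_cast this
  refine ⟨l₀, hnd, hout, hmem, fun lo up hlo hup hne => ?_, fun lo up a hlo hup hne => ?_⟩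
  · obtain ⟨l, hnd', hout', hmem', ht⟩ := hopp lo up hne
    have hlen : l.length ≤ l₀.length := by
      refine (hnd'.subperm fun r hr => ?_).length_le
      obtain ⟨g, hg, hgr⟩ := (hmem' r).1 hr
      exact (hmem r).2 ⟨g, isFeasible_of_restrict hg hlo hup, hgr⟩
    refine ⟨ht.trans ?_, l, hout', hlen, hmem'⟩
    have := P.encodeWith_size_le (hle lo up hne) hup P.oppositeCosts_size_le
    gcongr
  · obtain ⟨h₁, h₂, h₃⟩ := hf ⟨(P.restrict lo up).arcFlow a, hP.1, hne⟩
    change (f ((P.restrict lo up).arcFlow a).encode).out.Nodup at h₁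
    change ∀ w, w ∈ (f ((P.restrict lo up).arcFlow a).encode).out ↔
      w ∈ encodeVector '' ((P.restrict lo up).arcFlow a).supportedNondominated at h₂
    change τ ((P.restrict lo up).arcFlow a).encode ≤
      c * (((P.restrict lo up).arcFlow a).encode.size +
        (f ((P.restrict lo up).arcFlow a).encode).out.length + 1) ^ k at h₃
    rw [encode_arcFlow] at h₁ h₂ h₃
    obtain ⟨y, hy⟩ := (P.restrict lo up).arcFlow_supportedNondominated_nonempty a hne
    obtain ⟨g, hg, rfl, hmin⟩ := (P.restrict lo up).mem_arcFlow_supportedNondominated a hy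
    have hall : ∀ w ∈ (f (P.encodeWith lo up (P.arcFlowCosts a))).out,
        w = encodeVector fun _ : Fin 2 => (g a : ℚ) := by
      intro w hw
      obtain ⟨y', hy', rfl⟩ := (h₂ w).1 hw
      obtain ⟨g', hg', rfl, hmin'⟩ := (P.restrict lo up).mem_arcFlow_supportedNondominated a hy'
      rw [le_antisymm (hmin' g hg) (hmin g' hg')]
    have hin := (h₂ _).2 ⟨_, hy, rfl⟩
    have heq : (f (P.encodeWith lo up (P.arcFlowCosts a))).out =
        [encodeVector fun _ : Fin 2 => (g a : ℚ)] :=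
      List.perm_singleton.mp ((List.perm_ext_iff_of_nodup h₁ (List.nodup_singleton _)).2
        fun w => ⟨fun hw => by simpa using hall w hw, fun hw => by
          rw [List.mem_singleton.mp hw]; exact hin⟩)
    refine ⟨h₃.trans ?_, g, hg, heq, hmin⟩
    have := P.encodeWith_size_le (hle lo up hne) hup (P.arcFlowCosts_size_le a)
    -- Feasibility of `P` gives at least one value, so the single answer of a minimum query is
    -- covered by `l₀.length`.
    have hpos : 1 ≤ l₀.length := by
      obtain ⟨g, hg⟩ := hP.2
      exact List.length_pos_of_mem ((hmem _).2 ⟨g, hg, rfl⟩)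
    rw [heq, List.length_singleton]
    gcongr

theorem upper_size_le (P : MCIF 1) (a : Fin P.m) : (P.upper a).size ≤ P.encode.size := by
  have h : (P.upper a : ℤ) ∈ P.encode := by
    rw [encode_eq, encodeWith]
    simp only [List.mem_append, List.mem_flatMap]
    exact Or.inr ⟨a, List.mem_finRange a, by simp⟩
  have := List.single_le_sum (l := P.encode.map fun z => z.natAbs.size + 1) (by simp) _
    (List.mem_map_of_mem h)
  simp only [Int.natAbs_natCast] at this
  exact (Nat.le_succ _).trans this

end Reduction

/-! ### From the assumed enumerator to a machine for ACVF. -/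

open Reduction in
theorem acvfSolvable_of_supportedNondominatedEnumerable (h : SupportedNondominatedEnumerable) :
    ACVFSolvable := by
  obtain ⟨p, hterm, c, k, hp⟩ := h
  have hex : ∀ w : RAM.Word, ∃ s : ℕ × RAM.State, RAM.Exec p (.init w) s.1 s.2 := by
    intro w
    obtain ⟨t, out, s, hs, -⟩ := hterm w
    exact ⟨(t, s), hs⟩
  choose F hF using hex
  set f : RAM.Word → RAM.State := fun w => (F w).2 with hf
  set τ : RAM.Word → ℕ := fun w => (F w).1 with hτ
  have hspec : ∀ Q : Instance 2, (f Q.encode).out.Nodup ∧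
      (∀ w, w ∈ (f Q.encode).out ↔ w ∈ encodeVector '' Q.1.supportedNondominated) ∧
      τ Q.encode ≤ c * (Q.encode.size + (f Q.encode).out.length + 1) ^ k := by
    intro Q
    obtain ⟨t, out, ⟨s, hs, rfl⟩, ⟨h₁, h₂⟩, h₃⟩ := hp Q
    -- The runs chosen for arbitrary words and the correct, fast runs promised for instances agree
    -- by determinism.
    obtain ⟨rfl, rfl⟩ := hs.deterministic (hF Q.encode)
    exact ⟨h₁, h₂, h₃⟩
  refine ⟨main.toProgram p varCode arrCode, fun w => ?_, ?_⟩
  · obtain ⟨t, ht, -⟩ := RAM.Cmd.runs_toProgram (f := f) (τ := τ) hF varCode arrCode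
      (fun x => Nat.succ_ne_zero _) (a := Arr.input) rfl main w
    exact ⟨t, _, ht⟩
  -- The exponent adds the 4 of `mainTime_le` to the `k` of the enumerator; `4 ^ k` stems from the
  -- longer query encodings.
  refine ⟨(RAM.Guest.bound p + 10) * (300 * (1 + c * 4 ^ k)) + 1, k + 4, fun P => ?_⟩
  obtain ⟨t, hrun, ht⟩ := RAM.Cmd.runs_toProgram (f := f) (τ := τ) hF varCode arrCode
    (fun x => Nat.succ_ne_zero _) (a := Arr.input) rfl main P.encode
  obtain ⟨l₀, hnd, hout, hmem, hO⟩ := oracle_of_enumeration hspec P.1 P.2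
  obtain ⟨⟨gs, h₁, h₂, h₃⟩, hcost⟩ := main_spec hO (upper_size_le P.1) hout
    (fun r hr => (hmem r).1 hr) P.2.2
  refine ⟨t, _, hrun, ?_, ?_⟩
  · change ∃ fs, _ ∧ (main.eval f (.init .input P.1.encode)).out.Perm _
    rw [h₁]
    -- Any output order is allowed, so the sorting takes place only in this proof, not on the
    -- machine. Distinctness of the values in `l₀` makes the sorted costs strictly increasing.
    set le : (Fin P.1.m → ℤ) → (Fin P.1.m → ℤ) → Bool :=
      fun g g' => decide (P.1.outcome g 0 ≤ P.1.outcome g' 0) with hle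
    have hperm := List.mergeSort_perm gs le
    refine ⟨gs.mergeSort le, ⟨fun g hg => h₂ g (hperm.subset hg), ?_, fun g hg => ?_⟩,
      (hperm.map _).symm⟩
    · have hsorted : (gs.mergeSort le).Pairwise fun g g' => P.1.outcome g 0 ≤ P.1.outcome g' 0 := by
        have := List.pairwise_mergeSort (le := le) (fun a b c hab hbc => by
          simp only [hle, decide_eq_true_eq] at *; exact hab.trans hbc)
          (fun a b => by simpa [hle] using le_total _ _) gs
        simpa [hle] using this
      have hnodup : (gs.mergeSort le).Pairwise fun g g' =>
          P.1.outcome g 0 ≠ P.1.outcome g' 0 := by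
        rw [← List.pairwise_map (R := (· ≠ ·)) (f := fun g => P.1.outcome g 0)]
        exact ((hperm.map _).nodup_iff).2 (h₃ ▸ hnd)
      exact (hsorted.and hnodup).imp fun h => lt_of_le_of_ne h.1 h.2
    · have : P.1.outcome g 0 ∈ gs.map fun g => P.1.outcome g 0 := by
        rw [h₃]; exact (hmem _).2 ⟨g, hg, rfl⟩
      obtain ⟨g', hg', heq⟩ := List.mem_map.mp this
      exact ⟨g', hperm.symm.subset hg', heq⟩
  · have hlen : (main.eval f (.init .input P.encode)).out.length = l₀.length := by
      change (main.eval f (.init .input P.1.encode)).out.length = _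
      rw [h₁, ← h₃, List.length_map, List.length_map]
    rw [hlen]
    set N := P.encode.size + l₀.length + 1 with hN
    have hlen' := length_le_size P.1.encode
    rw [encode_length] at hlen'
    have hsz : P.1.encode.size = P.encode.size := rfl
    have hmain := mainTime_le (P := P.1) (l₀ := l₀)
      (T := c * (4 * P.1.encode.size + l₀.length + 1) ^ k) (S := P.1.encode.size) (N := N)
      (by omega) (by omega) (by omega) (by omega)
    have hT : 1 + c * (4 * P.1.encode.size + l₀.length + 1) ^ k ≤ (1 + c * 4 ^ k) * N ^ k := by
      have h₁ : (4 * P.1.encode.size + l₀.length + 1) ^ k ≤ (4 * N) ^ k :=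
        Nat.pow_le_pow_left (by omega) k
      rw [mul_pow] at h₁
      have h₂ := Nat.mul_le_mul_left c h₁
      have h₃ : 1 ≤ N ^ k := Nat.one_le_pow _ _ (by omega)
      calc _ ≤ N ^ k + c * (4 ^ k * N ^ k) := by omega
        _ = _ := by ring
    have hcost' : main.cost f τ (.init .input P.encode) ≤
        300 * N ^ 4 * ((1 + c * 4 ^ k) * N ^ k) :=
      hcost.trans (hmain.trans (Nat.mul_le_mul_left _ hT))
    have hone : 1 ≤ N ^ (k + 4) := Nat.one_le_pow _ _ (by omega)
    calc t ≤ (RAM.Guest.bound p + 10) * (300 * N ^ 4 * ((1 + c * 4 ^ k) * N ^ k)) + 1 :=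
          ht.trans (Nat.add_le_add_right (Nat.mul_le_mul_left _ hcost') 1)
      _ = (RAM.Guest.bound p + 10) * (300 * (1 + c * 4 ^ k)) * N ^ (k + 4) + 1 := by ring
      _ ≤ (RAM.Guest.bound p + 10) * (300 * (1 + c * 4 ^ k)) * N ^ (k + 4) + N ^ (k + 4) := by
          omega
      _ = _ := by ring

end MCIF

theorem mainTheorem4 :
    (MCIF.SupportedNondominatedEnumerable → MCIF.ACVFSolvable) ∧
    ∀ (P : MCIF 1) (f : Fin P.m → ℤ), P.IsFeasible f →
      P.opposite.outcome f = ![P.outcome f 0, - P.outcome f 0] ∧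
      P.opposite.outcome f ∈ P.opposite.supportedNondominated ∧
      P.opposite.outcome f 0 + P.opposite.outcome f 1 = 0 := by
  refine ⟨MCIF.acvfSolvable_of_supportedNondominatedEnumerable, fun P f hf =>
    ⟨P.opposite_outcome f, ⟨f, P.opposite_isSupportedEfficient hf, rfl⟩, ?_⟩⟩
  rw [P.opposite_outcome f]
  simp
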